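/- Let $\mathbb{H}$ be the algebra of quaternions, $\mathbb{S}=\{I\in\mathbb{H}: I^2=-1\}$, and $L_I=\mathbb{R}+I\mathbb{R}\cong\mathbb{C}$ for $I\in\mathbb{S}$. For $\Omega\subseteq\mathbb{H}$ put $\Omega_I=\Omega\cap L_I$. A domain (nonempty connected open set) $\Omega\subseteq\mathbb{H}$ is a *slice domain* if it meets $\mathbb{R}$ and $\Omega_I$ is connected for every $I\in\mathbb{S}$; it is *symmetric* if $x+Iy\in\Omega$ implies $x+Jy\in\Omega$ for all $x,y\in\mathbb{R}$ and $I,J\in\mathbb{S}$. A function $\upsilon:U\to[-\infty,\infty)$ on an open set $U\subseteq\mathbb{C}$ is *subharmonic* if it is upper semicontinuous, not identically $-\infty$ on any connected component of $U$, and, for every relatively compact open subset $G$ of $U$ and every real function $h$ continuous on $\overline G$ and harmonic in $G$, $\upsilon\le h$ on $\partial G$ implies $\upsilon\le h$ in $G$. The *complex Green function* $\gamma^U_a$ of $U$ with logarithmic pole at $a\in U$ is the pointwise supremum of all negative subharmonic functions $\upsilon$ on $U$ with $\upsilon(z)-\log|z-a|\le O(1)$ as $z\to a$ ($\sup\emptyset=-\infty$).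 For a domain $\Omega\subseteq\mathbb{H}$, $\mathsf{wsh}(\Omega)$ is the set of upper semicontinuous $u:\Omega\to[-\infty,+\infty)$, $u\not\equiv-\infty$, such that for every $I\in\mathbb{S}$ the restriction $u|_{\Omega_I}$ is subharmonic (identifying $L_I$ with $\mathbb{C}$), and, for $q_0\in\Omega$, $$\mathsf{wsh}_{q_0}(\Omega)=\Big\{u\in\mathsf{wsh}(\Omega): u<0,\ \limsup_{q\to q_0}\big|u(q)-\log|q-q_0|\big|<\infty\Big\}.$$ The *quaternionic Green function* $g^\Omega_{q_0}$ is the upper semicontinuous regularization on $\Omega$ of $w(q)=\sup\{u(q):u\in\mathsf{wsh}_{q_0}(\Omega)\}$ (with $w\equiv-\infty$ if the class is empty). Let $\mathbb{J}$ be the complex structure $\mathbb{J}_qv=\frac{\mathrm{Im}(q)}{|\mathrm{Im}(q)|}v$ on $\mathbb{H}\setminus\mathbb{R}$. A function $u:W\to[-\infty,\infty)$ on an open set $W\subseteq\mathbb{H}\setminus\mathbb{R}$ is *$\mathbb{J}$-plurisubharmonic* if it is plurisubharmonic with respect to $\mathbb{J}$: it is upper semicontinuous, not identically $-\infty$ on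 any connected component of $W$, and for every domain $V\subseteq\mathbb{C}$ and every holomorphic map $\varphi:V\to(W,\mathbb{J})$ the function $u\circ\varphi$ is subharmonic or identically $-\infty$ on $V$. **Theorem.** Let $\Omega\subseteq\mathbb{H}$ be a bounded symmetric slice domain and let $x_0\in\Omega\cap\mathbb{R}$. Let $\gamma^{\Omega_i}_{x_0}$ be the complex Green function of $\Omega_i=\Omega\cap\mathbb{C}$ with logarithmic pole at $x_0$. Set $$u(x+Iy):=\gamma^{\Omega_i}_{x_0}(x+iy)$$ for all $x,y\in\mathbb{R}$ and $I\in\mathbb{S}$ such that $x+Iy\in\Omega$. Then: 1. $u$ is a well-defined function on $\Omega$; 2. $u$ is $\mathbb{J}$-plurisubharmonic in $\Omega\setminus\mathbb{R}$ and it belongs to $\mathsf{wsh}_{x_0}(\Omega)$; 3. $u$ coincides with $g^\Omega_{x_0}$ on $\Omega$. -/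

import Mathlib

open Filter Topology
open scoped Quaternion

noncomputable section

namespace SliceGreen

/-! ### Subharmonic functions in the plane -/

/-- `u : U → [-∞, ∞)` is subharmonic on the open set `U ⊆ ℂ`: it is upper semicontinuous, it is not
identically `-∞` on any connected component of `U`, and it is dominated inside each relatively
compact open subset `G` of `U` by every continuous function on `closure G`, harmonic in `G`, which
dominates it on the boundary of `G`. Only the values of `u` on `U` matter. -/
structure IsSubharmonicOn (u : ℂ → EReal) (U : Set ℂ) : Prop where
  upperSemicontinuousOn : UpperSemicontinuousOn u U
  ne_top : ∀ z ∈ U, u z ≠ ⊤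
  exists_ne_bot : ∀ z ∈ U, ∃ w ∈ connectedComponentIn U z, u w ≠ ⊥
  le_of_le_frontier : ∀ G : Set ℂ, IsOpen G → IsCompact (closure G) → closure G ⊆ U →
    ∀ h : ℂ → ℝ, ContinuousOn h (closure G) → InnerProductSpace.HarmonicOnNhd h G →
      (∀ z ∈ frontier G, u z ≤ (h z : EReal)) → ∀ z ∈ G, u z ≤ (h z : EReal)

/-- The negative subharmonic functions on `U` with a logarithmic pole at `a`, that is, with
`u z - log ‖z - a‖ ≤ O(1)` as `z → a`. -/
def negSubharmonicWithPole (U : Set ℂ) (a : ℂ) : Set (ℂ → EReal) :=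
  {u | IsSubharmonicOn u U ∧ (∀ z ∈ U, u z < 0) ∧
    limsup (fun z => u z - (Real.log ‖z - a‖ : EReal)) (𝓝[U \ {a}] a) < ⊤}

/-- The complex Green function of `U` with logarithmic pole at `a`: the supremum of the negative
subharmonic functions on `U` with a logarithmic pole at `a` (the supremum of `∅` is `-∞`). -/
def complexGreen (U : Set ℂ) (a : ℂ) (z : ℂ) : EReal :=
  ⨆ u ∈ negSubharmonicWithPole U a, u z

/-! ### Quaternions, slices, and the complex structure `𝕁` -/

/-- The sphere `𝕊` of quaternionic imaginary units. -/
def imUnits : Set ℍ[ℝ] := {I | I * I = -1}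

/-- The imaginary unit `i`. -/
def unitI : ℍ[ℝ] := ⟨0, 1, 0, 0⟩

/-- The quaternion `x + I y` associated with `z = x + i y`; for `I ∈ 𝕊` this is the natural
identification of `ℂ` with `L_I = ℝ + I ℝ`. -/
def toSlice (I : ℍ[ℝ]) (z : ℂ) : ℍ[ℝ] := (z.re : ℍ[ℝ]) + I * (z.im : ℍ[ℝ])

/-- The slice `Ω_I = Ω ∩ L_I`, read in `ℂ` through the natural identification `L_I ≅ ℂ`. -/
def slice (Ω : Set ℍ[ℝ]) (I : ℍ[ℝ]) : Set ℂ := toSlice I ⁻¹' Ω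

/-- The real axis in `ℍ`. -/
def realAxis : Set ℍ[ℝ] := Set.range (fun x : ℝ => (x : ℍ[ℝ]))

/-- A domain: a nonempty connected open set. -/
def IsDomainSet (Ω : Set ℍ[ℝ]) : Prop := IsOpen Ω ∧ IsConnected Ω

/-- A slice domain meets the real axis, and all its slices are connected. -/
structure IsSliceDomain (Ω : Set ℍ[ℝ]) : Prop where
  isDomainSet : IsDomainSet Ω
  inter_realAxis_nonempty : (Ω ∩ realAxis).Nonempty
  isConnected_slice : ∀ I ∈ imUnits, IsConnected (Ω ∩ Set.range (toSlice I))

/-- Axial symmetry with respect to the real axis. -/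
def IsAxiallySymmetric (Ω : Set ℍ[ℝ]) : Prop :=
  ∀ (x y : ℝ), ∀ I ∈ imUnits, ∀ J ∈ imUnits,
    (x : ℍ[ℝ]) + I * (y : ℍ[ℝ]) ∈ Ω → (x : ℍ[ℝ]) + J * (y : ℍ[ℝ]) ∈ Ω

/-- The almost complex structure `𝕁_q v = (Im q / |Im q|) v` on `ℍ ∖ ℝ`. -/
def complexStructJ (q v : ℍ[ℝ]) : ℍ[ℝ] := (‖q.im‖⁻¹ • q.im) * v

/-- `φ` is a holomorphic map from the open set `V ⊆ ℂ` into `(U, 𝕁)`, for `U ⊆ ℍ ∖ ℝ` open: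
it is real differentiable, with differential intertwining `i` and `𝕁`. -/
structure IsJHolomorphicOn (φ : ℂ → ℍ[ℝ]) (V : Set ℂ) (U : Set ℍ[ℝ]) : Prop where
  mapsTo : Set.MapsTo φ V U
  differentiableAt : ∀ z ∈ V, DifferentiableAt ℝ φ z
  fderiv_I_mul : ∀ z ∈ V, ∀ v : ℂ,
    fderiv ℝ φ z (Complex.I * v) = complexStructJ (φ z) (fderiv ℝ φ z v)

/-- `u : U → [-∞, ∞)` is plurisubharmonic on the open set `U ⊆ ℍ ∖ ℝ` with respect to the complex
structure `𝕁`: it is upper semicontinuous, not identically `-∞` on any connected component of `U`,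
and its composition with each holomorphic map from a planar domain into `(U, 𝕁)` is either
identically `-∞` or subharmonic. -/
structure IsJPlurisubharmonicOn (u : ℍ[ℝ] → EReal) (U : Set ℍ[ℝ]) : Prop where
  upperSemicontinuousOn : UpperSemicontinuousOn u U
  ne_top : ∀ q ∈ U, u q ≠ ⊤
  exists_ne_bot : ∀ q ∈ U, ∃ p ∈ connectedComponentIn U q, u p ≠ ⊥
  comp_holomorphic : ∀ (V : Set ℂ) (φ : ℂ → ℍ[ℝ]), IsOpen V → IsConnected V →
    IsJHolomorphicOn φ V U → (∀ z ∈ V, u (φ z) = ⊥) ∨ IsSubharmonicOn (u ∘ φ) V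

/-! ### Weakly subharmonic functions and the quaternionic Green function -/

/-- The class `us(Ω)` of upper semicontinuous functions `Ω → [-∞, ∞)`, not identically `-∞`. -/
def us (Ω : Set ℍ[ℝ]) : Set (ℍ[ℝ] → EReal) :=
  {u | UpperSemicontinuousOn u Ω ∧ (∀ q ∈ Ω, u q ≠ ⊤) ∧ ∃ q ∈ Ω, u q ≠ ⊥}

/-- The class `wsh(Ω)` of weakly subharmonic functions: all restrictions `u_I` are subharmonic. -/
def wsh (Ω : Set ℍ[ℝ]) : Set (ℍ[ℝ] → EReal) :=
  {u | u ∈ us Ω ∧ ∀ I ∈ imUnits, IsSubharmonicOn (u ∘ toSlice I) (slice Ω I)}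

/-- The class `wsh_{q₀}(Ω)` of negative weakly subharmonic functions with
`limsup_{q → q₀} |u q - log |q - q₀|| < ∞`. -/
def wshPole (Ω : Set ℍ[ℝ]) (q₀ : ℍ[ℝ]) : Set (ℍ[ℝ] → EReal) :=
  {u | u ∈ wsh Ω ∧ (∀ q ∈ Ω, u q < 0) ∧
    limsup (fun q => (u q - (Real.log ‖q - q₀‖ : EReal)).abs) (𝓝[Ω \ {q₀}] q₀) < ⊤}

/-- The supremum `w` of the class `wsh_{q₀}(Ω)` (equal to `-∞` if the class is empty). -/
def supWshPole (Ω : Set ℍ[ℝ]) (q₀ : ℍ[ℝ]) (q : ℍ[ℝ]) : EReal :=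
  ⨆ u ∈ wshPole Ω q₀, u q

/-- The quaternionic Green function `g^Ω_{q₀}`: the upper semicontinuous regularization of `w`
on `Ω`. -/
def quatGreen (Ω : Set ℍ[ℝ]) (q₀ : ℍ[ℝ]) (q : ℍ[ℝ]) : EReal :=
  limsup (supWshPole Ω q₀) (𝓝[Ω] q)

/-- `u` satisfies `u (x + I y) = γ (x + i y)` for all real `x`, `y` and all `I ∈ 𝕊` such that
`x + I y ∈ Ω`. -/
def IsSpread (Ω : Set ℍ[ℝ]) (γ : ℂ → EReal) (u : ℍ[ℝ] → EReal) : Prop :=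
  ∀ (x y : ℝ), ∀ I ∈ imUnits, (x : ℍ[ℝ]) + I * (y : ℍ[ℝ]) ∈ Ω →
    u ((x : ℍ[ℝ]) + I * (y : ℍ[ℝ])) = γ ((x : ℂ) + (y : ℂ) * Complex.I)

end SliceGreen

end

noncomputable section

namespace SliceGreen

/-! Everything reduces to the folding map `toHalf`, `x + I y ↦ x + i |y|`: by symmetry all slices
are one planar domain `D`, and the spread of the planar Green function `γ` of `D` is `γ ∘ toHalf`.

Well-definedness: a nonreal quaternion determines `(I, y)` only up to a common sign, so what is
needed is `γ (conj z) = γ z`. Conjugation permutes the competitors because the pole is real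
(`complexGreen_conj`).

Regularity: on a bounded domain `γ` is its own competitor (`complexGreen_mem`). Its upper
semicontinuous regularization still satisfies the maximum principle, is strictly negative by the
strong maximum principle, and keeps the bound `log |z - a| - log r` on an inscribed disc; hence it
lies below `γ`. With the lower bound `log |z - a| - log R` from an enclosing disc, this gives the
two-sided pole condition of `wshPole`.

Plurisubharmonicity: `toHalf` is holomorphic from `(ℍ ∖ ℝ, 𝕁)` to `ℂ`, so it suffices that
subharmonic composed with holomorphic is subharmonic (`IsSubharmonicOn.comp_holomorphic`). Since
subharmonicity is defined by comparison on arbitrary relatively compact open sets, it is first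
localized to small discs (`isDominated_of_isCenterDominated`).

Equality: a quaternionic competitor restricts on each slice to a planar one, so it lies below the
spread `u`, which is itself a competitor. Thus the supremum is `u` on `Ω`, and regularizing changes
nothing because `u` is upper semicontinuous. -/

open Metric InnerProductSpace

/-! ### Domination by harmonic functions: local versus global -/

/-- `u` satisfies the maximum principle relative to harmonic functions inside `U`. -/
def IsDominated (u : ℂ → EReal) (U : Set ℂ) : Prop :=
  ∀ G : Set ℂ, IsOpen G → IsCompact (closure G) → closure G ⊆ U →
    ∀ h : ℂ → ℝ, ContinuousOn h (closure G) → HarmonicOnNhd h G →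
      (∀ z ∈ frontier G, u z ≤ (h z : EReal)) → ∀ z ∈ G, u z ≤ (h z : EReal)

/-- On all small discs centred at `z₀`, the value of `u` at the centre is dominated by each
harmonic function dominating `u` on the boundary circle. -/
def IsCenterDominated (u : ℂ → EReal) (z₀ : ℂ) : Prop :=
  ∃ R > 0, ∀ r, 0 < r → r < R → ∀ h : ℂ → ℝ, ContinuousOn h (closedBall z₀ r) →
    HarmonicOnNhd h (ball z₀ r) → (∀ z ∈ sphere z₀ r, u z ≤ (h z : EReal)) → u z₀ ≤ (h z₀ : EReal)

theorem ereal_add_neg_le_iff (x : EReal) (a b : ℝ) :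
    x + ((-a : ℝ) : EReal) ≤ (b : EReal) ↔ x ≤ ((a + b : ℝ) : EReal) := by
  induction x with
  | bot => simp
  | top => rw [EReal.top_add_coe]; simp only [top_le_iff, EReal.coe_ne_top]
  | coe x =>
    norm_cast
    constructor <;> intro h <;> linarith

theorem upperSemicontinuousOn_add_neg {u : ℂ → EReal} {h : ℂ → ℝ} {s : Set ℂ}
    (hu : UpperSemicontinuousOn u s) (hh : ContinuousOn h s) :
    UpperSemicontinuousOn (fun z => u z + ((-h z : ℝ) : EReal)) s := by
  refine hu.add' ?_ fun z _ => EReal.continuousAt_add (by simp) (by simp)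
  have : ContinuousOn (fun z => ((-h z : ℝ) : EReal)) s :=
    continuous_coe_real_ereal.comp_continuousOn hh.neg
  exact this.upperSemicontinuousOn

theorem _root_.UpperSemicontinuousOn.eventually_lt {X : Type*} [TopologicalSpace X]
    {u : X → EReal} {s : Set X} {x : X} {t : EReal} (hu : UpperSemicontinuousOn u s)
    (hs : s ∈ 𝓝 x) (ht : u x < t) : ∀ᶠ y in 𝓝 x, u y < t := by
  have := hu x (mem_of_mem_nhds hs) t ht
  rwa [nhdsWithin_eq_nhds.2 hs] at this

theorem exists_real_lt_forall_le {w : ℂ → EReal} {s : Set ℂ} (hs : IsCompact s)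
    (hw : UpperSemicontinuousOn w s) {m : ℝ} (hm : ∀ z ∈ s, w z < m) :
    ∃ m' : ℝ, m' < m ∧ ∀ z ∈ s, w z ≤ (m' : EReal) := by
  rcases s.eq_empty_or_nonempty with rfl | hne
  · exact ⟨m - 1, by linarith, by simp⟩
  · obtain ⟨a, ha, hmax⟩ := hw.exists_isMaxOn hne hs
    obtain ⟨m', h1, h2⟩ := EReal.lt_iff_exists_real_btwn.1 (hm a ha)
    exact ⟨m', by exact_mod_cast h2, fun z hz => (hmax hz).trans h1.le⟩

theorem harmonicAt_re_mul (c a : ℂ) (z : ℂ) :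
    HarmonicAt (fun w : ℂ => ((w - a) * c).re) z := by
  have : AnalyticAt ℂ (fun w : ℂ => (w - a) * c) z := by fun_prop
  exact this.harmonicAt_re

/-- A function dominated at the centres of small discs is dominated globally. -/
theorem isDominated_of_isCenterDominated {u : ℂ → EReal} {U : Set ℂ}
    (husc : UpperSemicontinuousOn u U) (htop : ∀ z ∈ U, u z ≠ ⊤)
    (hc : ∀ z ∈ U, IsCenterDominated u z) : IsDominated u U := by
  intro G hG hGc hGU h hh hharm hfr z₁ hz₁
  by_contra hlt
  rw [not_le] at hlt
  set w : ℂ → EReal := fun z => u z + ((-h z : ℝ) : EReal) with hw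
  have hwusc : UpperSemicontinuousOn w (closure G) :=
    upperSemicontinuousOn_add_neg (husc.mono hGU) hh
  have hle : ∀ z (b : ℝ), w z ≤ b ↔ u z ≤ ((h z + b : ℝ) : EReal) :=
    fun z b => ereal_add_neg_le_iff _ _ _
  obtain ⟨zm, hzm, hmax⟩ := hwusc.exists_isMaxOn ⟨z₁, subset_closure hz₁⟩ hGc
  have hpos : (0 : EReal) < w zm := by
    refine lt_of_lt_of_le ?_ (hmax (subset_closure hz₁))
    by_contra hcon
    have := (hle z₁ 0).1 (by simpa using hcon)
    rw [add_zero] at this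
    exact absurd this (not_le.2 hlt)
  obtain ⟨m, hm⟩ : ∃ m : ℝ, w zm = m := by
    have h1 : w zm ≠ ⊤ := by
      have := htop zm (hGU hzm)
      simp only [hw]
      exact EReal.add_ne_top this (EReal.coe_ne_top _)
    exact ⟨(w zm).toReal, (EReal.coe_toReal h1 (ne_bot_of_gt hpos)).symm⟩
  have hm0 : 0 < m := by rw [hm] at hpos; exact_mod_cast hpos
  have hlem : ∀ z ∈ closure G, w z ≤ m := fun z hz => hm ▸ hmax hz
  have hK : IsCompact (closure G ∩ w ⁻¹' Set.Ici (m : EReal)) :=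
    hwusc.isCompact_inter_preimage_Ici hGc _
  -- Among the maximum points of `w = u - h`, take one farthest from the origin: the maximum is not
  -- attained at any point of larger norm.
  obtain ⟨z₀, ⟨hz₀, hz₀m⟩, hext⟩ :=
    hK.exists_isMaxOn ⟨zm, hzm, hm.ge⟩ (continuous_norm.continuousOn)
  have hz₀G : z₀ ∈ G := by
    by_contra hcon
    have h1 : w z₀ ≤ (0 : ℝ) := by
      rw [hle, add_zero]
      exact hfr z₀ ⟨hz₀, by rwa [hG.interior_eq]⟩
    have h2 : (m : EReal) ≤ (0 : ℝ) := le_trans hz₀m h1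
    have : m ≤ 0 := by exact_mod_cast h2
    linarith
  obtain ⟨R, hR, hcen⟩ := hc z₀ (hGU hz₀)
  obtain ⟨R', hR', hball⟩ := Metric.isOpen_iff.1 hG z₀ hz₀G
  set r := min R R' / 2 with hr
  have hrpos : 0 < r := by positivity
  have hrR : r < R := by have := min_le_left R R'; have := lt_min hR hR'; linarith
  have hrR' : r < R' := by have := min_le_right R R'; have := lt_min hR hR'; linarith
  have hcb : closedBall z₀ r ⊆ G := (closedBall_subset_ball hrR').trans hball
  set c : ℂ := (starRingEnd ℂ) z₀
  -- On the circle, `|z|² = |z₀|² + 2 Re ((z - z₀) c) + r²`, so `p z ≥ 0` forces `|z| > |z₀|` and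
  -- hence `w z < m`. The shift `r² / 4` makes `p` positive at the centre, also when `z₀ = 0`.
  set p : ℂ → ℝ := fun z => ((z - z₀) * c).re + r ^ 2 / 4 with hp
  have hpcont : Continuous p := by fun_prop
  have hp0 : p z₀ = r ^ 2 / 4 := by simp [hp]
  have hSc : IsCompact (sphere z₀ r ∩ {z | 0 ≤ p z}) :=
    (isCompact_sphere _ _).inter_right (isClosed_le continuous_const hpcont)
  have hSsub : sphere z₀ r ∩ {z | 0 ≤ p z} ⊆ closure G := fun z hz =>
    subset_closure (hcb (sphere_subset_closedBall hz.1))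
  have hSlt : ∀ z ∈ sphere z₀ r ∩ {z | 0 ≤ p z}, w z < m := by
    intro z hz
    by_contra hcon
    rw [not_lt] at hcon
    have h1 : ‖z‖ ≤ ‖z₀‖ := hext ⟨hSsub hz, hcon⟩
    have h2 : ‖z - z₀‖ = r := by simpa [dist_eq_norm] using hz.1
    have h3 : 0 ≤ p z := hz.2
    have h4 : ‖z‖ ^ 2 ≤ ‖z₀‖ ^ 2 := by gcongr
    have h5 : ‖z - z₀‖ ^ 2 = r ^ 2 := by rw [h2]
    rw [← Complex.normSq_eq_norm_sq, Complex.normSq_apply] at h5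
    rw [← Complex.normSq_eq_norm_sq, ← Complex.normSq_eq_norm_sq, Complex.normSq_apply,
      Complex.normSq_apply] at h4
    simp only [hp, c, Complex.mul_re, Complex.sub_re, Complex.sub_im, Complex.conj_re,
      Complex.conj_im] at h3 h5
    nlinarith [pow_pos hrpos 2]
  obtain ⟨m', hm', hSm'⟩ := exists_real_lt_forall_le hSc (hwusc.mono hSsub) hSlt
  set P := r * ‖c‖ + r ^ 2 / 4 with hP
  have hPpos : 0 < P := by positivity
  have hpP : ∀ z ∈ sphere z₀ r, p z ≤ P := by
    intro z hz
    have h2 : ‖z - z₀‖ = r := by simpa [dist_eq_norm] using hz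
    have h3 := Complex.re_le_norm ((z - z₀) * c)
    rw [norm_mul, h2] at h3
    simp only [hp, hP]; linarith
  -- With this `ε`, `m - ε p` dominates `w` on the whole circle: by `m'` where `p ≥ 0`, by `m` where
  -- `p < 0`. At the centre it is smaller than `m`, a contradiction.
  set ε := (m - m') / P with hε
  have hεpos : 0 < ε := div_pos (by linarith) hPpos
  have hεP : ε * P = m - m' := div_mul_cancel₀ _ hPpos.ne'
  have key := hcen r hrpos hrR (fun z => h z + (m - ε * p z))
    ((hh.mono (hcb.trans subset_closure)).add (by fun_prop)) ?_ ?_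
  · have h1 : w z₀ ≤ ((m - ε * p z₀ : ℝ) : EReal) := (hle _ _).2 key
    have h2 : (m : EReal) ≤ ((m - ε * p z₀ : ℝ) : EReal) := le_trans hz₀m h1
    have h3 : m ≤ m - ε * p z₀ := by exact_mod_cast h2
    rw [hp0] at h3
    nlinarith [mul_pos hεpos (pow_pos hrpos 2)]
  · have hpharm : HarmonicOnNhd p (ball z₀ r) := fun z _ =>
      (harmonicAt_re_mul c z₀ z).add (harmonicAt_const _)
    have hharm' : HarmonicOnNhd h (ball z₀ r) :=
      hharm.mono (ball_subset_closedBall.trans hcb)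
    exact hharm'.add ((harmonicOnNhd_const m).sub (hpharm.const_smul (c := ε)))
  · intro z hz
    rw [← hle]
    have hzG : z ∈ closure G := subset_closure (hcb (sphere_subset_closedBall hz))
    by_cases hpz : 0 ≤ p z
    · refine (hSm' z ⟨hz, hpz⟩).trans ?_
      norm_cast
      have := mul_le_mul_of_nonneg_left (hpP z hz) hεpos.le
      linarith
    · refine (hlem z hzG).trans ?_
      norm_cast
      nlinarith

theorem IsDominated.isCenterDominated {u : ℂ → EReal} {U : Set ℂ} (hu : IsDominated u U)
    {z : ℂ} (hz : U ∈ 𝓝 z) : IsCenterDominated u z := by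
  obtain ⟨R, hR, hRU⟩ := Metric.mem_nhds_iff.1 hz
  refine ⟨R, hR, fun r hr hrR h hh hharm hle => ?_⟩
  have hcl : closure (ball z r) = closedBall z r := closure_ball z hr.ne'
  refine hu (ball z r) isOpen_ball (hcl ▸ isCompact_closedBall z r)
    (hcl ▸ (closedBall_subset_ball hrR).trans hRU) h (hcl ▸ hh) hharm ?_ z (mem_ball_self hr)
  rwa [frontier_ball z hr.ne']

/-- By the mean value property, `h - g` at the centre is its average over the circle, where it is
nonnegative. -/
theorem HarmonicAt.isCenterDominated {u : ℂ → EReal} {g : ℂ → ℝ} {z : ℂ}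
    (hg : HarmonicAt g z) (hu : ∀ᶠ w in 𝓝 z, u w = (g w : EReal)) : IsCenterDominated u z := by
  obtain ⟨R, hR, hball⟩ := Metric.eventually_nhds_iff_ball.1 (hg.eventually.and hu)
  refine ⟨R, hR, fun r hr hrR h hh hharm hle => ?_⟩
  have hgb : HarmonicOnNhd g (closedBall z r) := fun w hw =>
    (hball w (closedBall_subset_ball hrR hw)).1
  have hcont : HarmonicContOnCl (h - g) (ball z |r|) := by
    rw [abs_of_pos hr]
    exact HarmonicContOnCl.mk_ball (hharm.sub (hgb.mono ball_subset_closedBall))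
      (hh.sub hgb.continuousOn)
  have h0 : 0 ≤ Real.circleAverage (h - g) z r := by
    refine Real.circleAverage_nonneg_of_nonneg fun w hw => ?_
    rw [abs_of_pos hr] at hw
    have := hle w hw
    rw [(hball w (closedBall_subset_ball hrR (sphere_subset_closedBall hw))).2] at this
    simpa using (EReal.coe_le_coe_iff.1 this)
  rw [hcont.circleAverage_eq] at h0
  rw [(hball z (mem_ball_self hR)).2]
  exact_mod_cast sub_nonneg.1 h0

theorem isCenterDominated_of_eq_bot {u : ℂ → EReal} {z : ℂ} (hu : u z = ⊥) :
    IsCenterDominated u z :=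
  ⟨1, one_pos, fun _ _ _ _ _ _ _ => hu ▸ bot_le⟩

/-! ### Maximum principles on annuli and punctured discs -/

/-- The value of a dominated upper semicontinuous function is attained nearby in the limit. -/
theorem IsCenterDominated.frequently_le {u : ℂ → EReal} {z : ℂ} {U : Set ℂ}
    (hu : IsCenterDominated u z) (husc : UpperSemicontinuousOn u U) (hU : U ∈ 𝓝 z) :
    ∃ᶠ w in 𝓝[≠] z, u z ≤ u w := by
  intro hcon
  simp only [not_le] at hcon
  rw [eventually_nhdsWithin_iff] at hcon
  obtain ⟨R, hR, hc⟩ := hu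
  obtain ⟨R', hR', hball⟩ := Metric.eventually_nhds_iff_ball.1 (hcon.and hU)
  set r := min R R' / 2 with hr
  have hrpos : 0 < r := by positivity
  have hrR : r < R := by have := min_le_left R R'; have := lt_min hR hR'; linarith
  have hrR' : r < R' := by have := min_le_right R R'; have := lt_min hR hR'; linarith
  have hsb : sphere z r ⊆ ball z R' :=
    sphere_subset_closedBall.trans (closedBall_subset_ball hrR')
  obtain ⟨a, ha, hmax⟩ := (husc.mono fun w hw => (hball w (hsb hw)).2).exists_isMaxOn
    (NormedSpace.sphere_nonempty.2 hrpos.le) (isCompact_sphere z r)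
  have hne : a ≠ z := ne_of_mem_sphere ha hrpos.ne'
  -- The maximum over the circle would be below the central value, so a constant in between violates
  -- domination at the centre.
  obtain ⟨t, ht1, ht2⟩ := EReal.lt_iff_exists_real_btwn.1 ((hball a (hsb ha)).1 hne)
  have := hc r hrpos hrR (fun _ => t) continuousOn_const (harmonicOnNhd_const t)
    fun w hw => (hmax hw).trans ht1.le
  exact absurd this (not_le.2 ht2)

/-- The maximum principle on a round annulus. -/
theorem IsDominated.le_on_annulus {u : ℂ → EReal} {U : Set ℂ} (hu : IsDominated u U) {c : ℂ}
    {δ R : ℝ} (hsub : closedBall c R \ ball c δ ⊆ U) {h : ℂ → ℝ}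
    (hh : ContinuousOn h (closedBall c R \ ball c δ))
    (hharm : HarmonicOnNhd h (ball c R \ closedBall c δ))
    (hR : ∀ z ∈ sphere c R, u z ≤ (h z : EReal)) (hδ : ∀ z ∈ sphere c δ, u z ≤ (h z : EReal))
    {z : ℂ} (hz : z ∈ ball c R \ closedBall c δ) : u z ≤ (h z : EReal) := by
  have hG : IsOpen (ball c R \ closedBall c δ) := isOpen_ball.sdiff isClosed_closedBall
  have hcl : closure (ball c R \ closedBall c δ) ⊆ closedBall c R \ ball c δ :=
    closure_minimal (Set.sdiff_subset_sdiff ball_subset_closedBall ball_subset_closedBall)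
      (isClosed_closedBall.sdiff isOpen_ball)
  refine hu _ hG ((isCompact_closedBall c R).of_isClosed_subset isClosed_closure
    (hcl.trans Set.sdiff_subset)) (hcl.trans hsub) h (hh.mono hcl) hharm ?_ z hz
  rintro w ⟨hw1, hw2⟩
  rw [hG.interior_eq] at hw2
  have h1 := hcl hw1
  simp only [Set.mem_sdiff, mem_closedBall, mem_ball, not_lt] at h1 hw2
  by_cases h2 : dist w c < R
  · exact hδ w (mem_sphere.2 (le_antisymm (by by_contra h3; exact hw2 ⟨h2, h3⟩) h1.2))
  · exact hR w (mem_sphere.2 (le_antisymm h1.1 (not_lt.1 h2)))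

theorem harmonicAt_log_norm_sub {c z : ℂ} (hz : z ≠ c) :
    HarmonicAt (fun w : ℂ => Real.log ‖w - c‖) z :=
  AnalyticAt.harmonicAt_log_norm (f := fun w => w - c) (by fun_prop) (sub_ne_zero.2 hz)

theorem continuousOn_log_norm_sub (c : ℂ) :
    ContinuousOn (fun w : ℂ => Real.log ‖w - c‖) {c}ᶜ := by
  refine ContinuousOn.log (by fun_prop) fun z hz => ?_
  simpa [sub_eq_zero] using hz

/-- The maximum principle on a punctured disc, for functions bounded above near the puncture
relative to the majorant. -/
theorem IsDominated.le_on_punctured {u : ℂ → EReal} {U : Set ℂ} (hu : IsDominated u U) {c : ℂ}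
    {r : ℝ} (hsub : closedBall c r \ {c} ⊆ U) {h : ℂ → ℝ}
    (hh : ContinuousOn h (closedBall c r \ {c})) (hharm : HarmonicOnNhd h (ball c r \ {c}))
    (hr : ∀ z ∈ sphere c r, u z ≤ (h z : EReal))
    {A : ℝ} (hA : ∀ᶠ z in 𝓝[≠] c, u z ≤ ((h z + A : ℝ) : EReal)) {z : ℂ}
    (hz : z ∈ ball c r \ {c}) : u z ≤ (h z : EReal) := by
  have hzc : z ≠ c := hz.2
  have hzr : dist z c < r := hz.1
  have hzpos : 0 < dist z c := dist_pos.2 hzc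
  have hrpos : 0 < r := hzpos.trans hzr
  -- `L` vanishes on the outer circle and tends to `+∞` at `c`; any multiple `ε L` therefore absorbs
  -- the constant `A` on a small enough circle, and `ε` is finally made small.
  set L : ℂ → ℝ := fun w => Real.log r - Real.log ‖w - c‖ with hL
  have key : ∀ ε : ℝ, 0 < ε → u z ≤ ((h z + ε * L z : ℝ) : EReal) := by
    intro ε hε
    have hlog : Tendsto (fun δ : ℝ => ε * (Real.log r - Real.log δ)) (𝓝[>] 0) atTop := by
      refine Tendsto.const_mul_atTop hε ?_
      simpa [sub_eq_add_neg] using tendsto_atTop_add_const_left _ (Real.log r)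
        (tendsto_neg_atBot_atTop.comp (Real.tendsto_log_nhdsGT_zero))
    rw [eventually_nhdsWithin_iff] at hA
    obtain ⟨R', hR', hball⟩ := Metric.eventually_nhds_iff_ball.1 hA
    obtain ⟨δ, hδA, hδ⟩ := ((hlog.eventually_ge_atTop A).and
      (Ioo_mem_nhdsGT (lt_min hR' hzpos))).exists
    have hδ0 : 0 < δ := hδ.1
    have hsub' : closedBall c r \ ball c δ ⊆ closedBall c r \ {c} :=
      Set.sdiff_subset_sdiff_right (Set.singleton_subset_iff.2 (mem_ball_self hδ0))
    refine hu.le_on_annulus (c := c) (δ := δ) (R := r) (hsub'.trans hsub)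
      (h := fun w => h w + ε * L w) ?_ ?_ ?_ ?_ ⟨hz.1, ?_⟩
    · refine (hh.mono hsub').add (continuousOn_const.mul (continuousOn_const.sub
        ((continuousOn_log_norm_sub c).mono fun w hw => (hsub' hw).2)))
    · have h1 : ball c r \ closedBall c δ ⊆ ball c r \ {c} :=
        Set.sdiff_subset_sdiff_right (Set.singleton_subset_iff.2 (mem_closedBall_self hδ0.le))
      have h2 : HarmonicOnNhd L (ball c r \ closedBall c δ) := fun w hw =>
        (harmonicAt_const _).sub (harmonicAt_log_norm_sub (h1 hw).2)
      exact (hharm.mono h1).add (h2.const_smul (c := ε))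
    · intro w hw
      have : ‖w - c‖ = r := by simpa [dist_eq_norm] using hw
      simpa [hL, this] using hr w hw
    · intro w hw
      have hwδ : ‖w - c‖ = δ := by simpa [dist_eq_norm] using hw
      refine (hball w ?_ (ne_of_mem_sphere hw hδ0.ne')).trans ?_
      · rw [mem_ball, dist_eq_norm, hwδ]
        exact hδ.2.trans_le (min_le_left _ _)
      · norm_cast
        simp only [hL, hwδ]
        linarith
    · rw [mem_closedBall, not_le]
      exact hδ.2.trans_le (min_le_right _ _)
  refine EReal.le_of_forall_lt_iff_le.1 fun t ht => ?_
  have ht' : h z < t := by exact_mod_cast ht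
  have hLz : 0 < L z := by
    simp only [hL, ← dist_eq_norm]
    exact sub_pos.2 (Real.log_lt_log hzpos hzr)
  have := key ((t - h z) / L z) (div_pos (by linarith) hLz)
  rwa [div_mul_cancel₀ _ hLz.ne', add_sub_cancel] at this

/-- A point at which the value is attained nearby in the limit is removable. -/
theorem isCenterDominated_of_punctured {u : ℂ → EReal} {c : ℂ} {R : ℝ} (hR : 0 < R)
    (hu : IsDominated u (ball c R \ {c})) (husc : UpperSemicontinuousOn u (ball c R))
    (htop : u c ≠ ⊤) (hfreq : ∃ᶠ z in 𝓝[≠] c, u c ≤ u z) : IsCenterDominated u c := by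
  refine ⟨R, hR, fun r hr hrR h hh hharm hle => ?_⟩
  have hcb : closedBall c r ⊆ ball c R := closedBall_subset_ball hrR
  have hhc : ContinuousAt h c := hh.continuousAt (closedBall_mem_nhds c hr)
  obtain ⟨A, hA, -⟩ := EReal.lt_iff_exists_real_btwn.1 (lt_top_iff_ne_top.2 htop)
  have h1 : ∀ᶠ z in 𝓝 c, u z < A :=
    husc.eventually_lt (ball_mem_nhds c hR) hA
  have h2 : ∀ᶠ z in 𝓝 c, h c - 1 < h z := hhc.eventually (lt_mem_nhds (by linarith))
  have h3 : ∀ᶠ z in 𝓝[≠] c, u z ≤ ((h z + (A - h c + 1) : ℝ) : EReal) := by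
    refine (h1.and h2).filter_mono nhdsWithin_le_nhds |>.mono fun z hz => hz.1.le.trans ?_
    norm_cast
    linarith [hz.2]
  have h4 : ∀ᶠ z in 𝓝[≠] c, u z ≤ (h z : EReal) := by
    have : ball c r \ {c} ∈ 𝓝[≠] c := sdiff_mem_nhdsWithin_compl (ball_mem_nhds c hr) _
    filter_upwards [this] with z hz
    exact hu.le_on_punctured (Set.sdiff_subset_sdiff_left hcb)
      (hh.mono Set.sdiff_subset) (hharm.mono Set.sdiff_subset) hle h3 hz
  -- The bound holds off the centre. Points near `c` with `u c ≤ u z` carry it to `c` by continuity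
  -- of `h`.
  by_contra hcon
  obtain ⟨t, ht1, ht2⟩ := EReal.lt_iff_exists_real_btwn.1 (not_le.1 hcon)
  have h5 : ∀ᶠ z in 𝓝[≠] c, h z < t :=
    (hhc.eventually (gt_mem_nhds (by exact_mod_cast ht1))).filter_mono nhdsWithin_le_nhds
  obtain ⟨z, hz1, hz2, hz3⟩ := (hfreq.and_eventually (h4.and h5)).exists
  have : u c < u c := hz1.trans_lt (hz2.trans_lt (lt_trans (by exact_mod_cast hz3) ht2))
  exact lt_irrefl _ this

/-- The strong maximum principle, for nonpositive functions. -/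
theorem IsDominated.neg_of_exists_neg {u : ℂ → EReal} {U : Set ℂ} (hu : IsDominated u U)
    (hU : IsOpen U) (hUc : IsPreconnected U) (husc : UpperSemicontinuousOn u U)
    (hle : ∀ z ∈ U, u z ≤ 0) (hex : ∃ z ∈ U, u z < 0) : ∀ z ∈ U, u z < 0 := by
  have key : ∀ c ∈ U, u c < 0 → ∀ R, closedBall c R ⊆ U → ∀ z ∈ ball c R, u z < 0 := by
    intro c hc hcneg R hRU z hz
    have hRpos : 0 < R := pos_of_mem_ball hz
    obtain ⟨t, ht1, ht2⟩ := EReal.lt_iff_exists_real_btwn.1 hcneg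
    have ht0 : t < 0 := by exact_mod_cast ht2
    obtain ⟨R', hR', hball⟩ := Metric.eventually_nhds_iff_ball.1
      (husc.eventually_lt (hU.mem_nhds hc) ht1)
    by_cases hzR : dist z c < R'
    · exact (hball z hzR).trans ht2
    set δ := min R R' / 2 with hδ
    have hδ0 : 0 < δ := by positivity
    have hmin := lt_min hRpos hR'
    have hδR : δ < R := by have := min_le_left R R'; linarith
    have hδR' : δ < R' := by have := min_le_right R R'; linarith
    have hlog : 0 < Real.log R - Real.log δ := sub_pos.2 (Real.log_lt_log hδ0 hδR)
    -- Chosen so that the majorant `C (log |w - c| - log R)` equals `t` on the inner circle and `0`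
    -- on the outer one; it is negative in between.
    set C := -t / (Real.log R - Real.log δ) with hC
    have hC0 : 0 < C := div_pos (by linarith) hlog
    have hCt : C * (Real.log R - Real.log δ) = -t := div_mul_cancel₀ _ hlog.ne'
    have hzδ : δ < dist z c := by linarith
    refine (hu.le_on_annulus (c := c) (δ := δ) (R := R) (Set.sdiff_subset.trans hRU)
      (h := fun w => C * (Real.log ‖w - c‖ - Real.log R)) ?_ ?_ ?_ ?_
      ⟨hz, by simpa using hzδ⟩).trans_lt ?_
    · refine continuousOn_const.mul (((continuousOn_log_norm_sub c).mono ?_).sub continuousOn_const)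
      rintro w hw rfl
      exact hw.2 (mem_ball_self hδ0)
    · have : HarmonicOnNhd (fun w => Real.log ‖w - c‖ - Real.log R)
          (ball c R \ closedBall c δ) := by
        refine fun w hw => (harmonicAt_log_norm_sub ?_).sub (harmonicAt_const _)
        rintro rfl
        exact hw.2 (mem_closedBall_self hδ0.le)
      exact this.const_smul (c := C)
    · intro w hw
      have : ‖w - c‖ = R := by simpa [dist_eq_norm] using hw
      simpa [this] using hle w (hRU (sphere_subset_closedBall hw))
    · intro w hw
      have h1 : ‖w - c‖ = δ := by simpa [dist_eq_norm] using hw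
      refine (hball w (by rw [mem_ball, dist_eq_norm, h1]; exact hδR')).le.trans ?_
      norm_cast
      rw [h1]
      linarith
    · have : Real.log ‖z - c‖ < Real.log R := by
        rw [← dist_eq_norm]
        exact Real.log_lt_log (hδ0.trans hzδ) hz
      exact_mod_cast mul_neg_of_pos_of_neg hC0 (by linarith)
  have hloc : ∀ z ∈ U, ∃ r > 0, ball z r ⊆ U ∧
      ((∃ w ∈ ball z r, u w < 0) → ∀ w ∈ ball z r, u w < 0) := by
    intro z hz
    obtain ⟨R, hR, hRU⟩ := Metric.isOpen_iff.1 hU z hz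
    -- For `w` within `R / 4` of `z`, the ball of radius `R / 2` about `w` covers `ball z (R / 4)`,
    -- and its closure stays in `ball z R`.
    refine ⟨R / 4, by positivity, (ball_subset_ball (by linarith)).trans hRU, ?_⟩
    rintro ⟨w, hw, hwneg⟩ w' hw'
    rw [mem_ball] at hw hw'
    refine key w (hRU (by rw [mem_ball]; linarith)) hwneg (R / 2) ?_ w' ?_
    · refine fun y hy => hRU ?_
      rw [mem_closedBall] at hy
      rw [mem_ball]
      linarith [dist_triangle y w z]
    · rw [mem_ball]
      linarith [dist_triangle_right w' w z]
  choose! r hr0 hrU hr using hloc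
  by_contra! hcon
  obtain ⟨b, hb, hb0⟩ := hcon
  obtain ⟨a, ha, ha0⟩ := hex
  -- Balls about negative points and balls about nonnegative points cover `U`. Preconnectedness
  -- gives a common point, through which negativity passes to a nonnegative centre.
  obtain ⟨y, hyU, hyA, hyB⟩ := hUc (⋃ z ∈ {z ∈ U | u z < 0}, ball z (r z))
    (⋃ z ∈ {z ∈ U | 0 ≤ u z}, ball z (r z))
    (isOpen_biUnion fun _ _ => isOpen_ball) (isOpen_biUnion fun _ _ => isOpen_ball)
    (fun z hz => by
      rcases lt_or_ge (u z) 0 with h | h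
      · exact Or.inl (Set.mem_biUnion (x := z) ⟨hz, h⟩ (mem_ball_self (hr0 z hz)))
      · exact Or.inr (Set.mem_biUnion (x := z) ⟨hz, h⟩ (mem_ball_self (hr0 z hz))))
    ⟨a, ha, Set.mem_biUnion (x := a) ⟨ha, ha0⟩ (mem_ball_self (hr0 a ha))⟩
    ⟨b, hb, Set.mem_biUnion (x := b) ⟨hb, hb0⟩ (mem_ball_self (hr0 b hb))⟩
  simp only [Set.mem_iUnion] at hyA hyB
  obtain ⟨p, ⟨hpU, hp⟩, hyp⟩ := hyA
  obtain ⟨q, ⟨hqU, hq⟩, hyq⟩ := hyB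
  have h1 := hr p hpU ⟨p, mem_ball_self (hr0 p hpU), hp⟩ y hyp
  exact absurd (hr q hqU ⟨y, hyq, h1⟩ q (mem_ball_self (hr0 q hqU))) (not_lt.2 hq)

/-! ### Composition with conjugation and with holomorphic maps -/

theorem _root_.InnerProductSpace.HarmonicAt.exists_analytic_re {h : ℂ → ℝ} {z : ℂ}
    (hh : HarmonicAt h z) : ∃ F : ℂ → ℂ, AnalyticAt ℂ F z ∧ (fun w => (F w).re) =ᶠ[𝓝 z] h := by
  obtain ⟨R, hR, hball⟩ := Metric.eventually_nhds_iff_ball.1 hh.eventually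
  obtain ⟨F, hF, hFh⟩ := HarmonicOnNhd.exists_analyticOnNhd_ball_re_eq (f := h) (z := z) (R := R)
    hball
  exact ⟨F, hF z (mem_ball_self hR), hFh.eventuallyEq_of_mem (ball_mem_nhds z hR)⟩

theorem _root_.InnerProductSpace.HarmonicAt.comp_analyticAt {h : ℂ → ℝ} {g : ℂ → ℂ} {z : ℂ}
    (hh : HarmonicAt h (g z)) (hg : AnalyticAt ℂ g z) : HarmonicAt (fun w => h (g w)) z := by
  obtain ⟨F, hF, hFh⟩ := hh.exists_analytic_re
  exact (harmonicAt_congr_nhds (hFh.comp_tendsto hg.continuousAt)).1 (hF.comp hg).harmonicAt_re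

/-- If `h = Re F` locally, then `conj ∘ F ∘ conj` is holomorphic and has real part `h ∘ conj`. -/
theorem _root_.InnerProductSpace.HarmonicAt.comp_conj {h : ℂ → ℝ} {z : ℂ}
    (hh : HarmonicAt h ((starRingEnd ℂ) z)) :
    HarmonicAt (fun w => h ((starRingEnd ℂ) w)) z := by
  obtain ⟨F, hF, hFh⟩ := hh.exists_analytic_re
  have hG : AnalyticAt ℂ (fun w => (starRingEnd ℂ) (F ((starRingEnd ℂ) w))) z := by
    rw [Complex.analyticAt_iff_eventually_differentiableAt] at hF ⊢
    filter_upwards [Complex.continuous_conj.continuousAt.eventually hF] with w hw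
    have := hw.conj_conj
    rwa [Complex.conj_conj] at this
  refine (harmonicAt_congr_nhds ?_).1 hG.harmonicAt_re
  filter_upwards [Complex.continuous_conj.continuousAt.eventually hFh] with w hw
  simpa using hw

theorem IsDominated.comp_conj {u : ℂ → EReal} {U V : Set ℂ} (hu : IsDominated u U)
    (hVU : Set.MapsTo (starRingEnd ℂ) V U) : IsDominated (u ∘ starRingEnd ℂ) V := by
  intro G hG hGc hGV h hh hharm hfr z hz
  set e : ℂ ≃ₜ ℂ := Complex.conjCLE.toHomeomorph with he
  have hez : ∀ z, e z = (starRingEnd ℂ) z := fun z => rfl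
  have hee : ∀ z, e (e z) = z := fun z => by simp [hez]
  have hcl : closure (e ⁻¹' G) = e ⁻¹' closure G := (e.preimage_closure G).symm
  have hfr' : frontier (e ⁻¹' G) = e ⁻¹' frontier G := (e.preimage_frontier G).symm
  have key := hu (e ⁻¹' G) (hG.preimage e.continuous) (hcl ▸ e.isCompact_preimage.2 hGc) ?_
    (h ∘ e) ?_ ?_ ?_ (e z) (by simpa [hee] using hz)
  · simpa [hee, hez] using key
  · rw [hcl]
    intro w hw
    simpa [hez] using hVU (hGV hw)
  · rw [hcl]
    exact hh.comp e.continuous.continuousOn fun w hw => hw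
  · exact fun w hw => HarmonicAt.comp_conj (hharm _ hw)
  · rw [hfr']
    intro w hw
    simpa [hez] using hfr _ hw

/-- Pulling back by a conformal map preserves domination at centres of small discs. -/
theorem IsDominated.comp_of_deriv_ne_zero {u : ℂ → EReal} {U : Set ℂ} (hu : IsDominated u U)
    {f : ℂ → ℂ} {z₀ : ℂ} (hU : U ∈ 𝓝 (f z₀)) (hf : AnalyticAt ℂ f z₀) (hf' : deriv f z₀ ≠ 0) :
    IsCenterDominated (u ∘ f) z₀ := by
  have hstrict := hf.hasStrictDerivAt.hasStrictFDerivAt_equiv hf'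
  set e : OpenPartialHomeomorph ℂ ℂ := hstrict.toOpenPartialHomeomorph f with he
  have hef : ∀ z, e z = f z := fun z => rfl
  have hsrc : z₀ ∈ e.source := hstrict.mem_toOpenPartialHomeomorph_source
  have hev : ∀ᶠ z in 𝓝 z₀, z ∈ e.source ∧ f z ∈ U ∧ AnalyticAt ℂ f z ∧ deriv f z ≠ 0 :=
    Filter.Eventually.and (e.open_source.mem_nhds hsrc) ((hf.continuousAt.eventually hU).and
      (hf.eventually_analyticAt.and (hf.deriv.continuousAt.eventually_ne hf')))
  obtain ⟨R, hR, hball⟩ := Metric.eventually_nhds_iff_ball.1 hev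
  refine ⟨R, hR, fun r hr hrR h hh hharm hle => ?_⟩
  have hcb : closedBall z₀ r ⊆ ball z₀ R := closedBall_subset_ball hrR
  have hcs : closedBall z₀ r ⊆ e.source := fun z hz => (hball z (hcb hz)).1
  have hbs : ball z₀ r ⊆ e.source := ball_subset_closedBall.trans hcs
  have hcomp : IsCompact (e '' closedBall z₀ r) :=
    (isCompact_closedBall z₀ r).image_of_continuousOn (e.continuousOn.mono hcs)
  have hopen : IsOpen (e '' ball z₀ r) := e.isOpen_image_of_subset_source isOpen_ball hbs
  have hcl : closure (e '' ball z₀ r) ⊆ e '' closedBall z₀ r :=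
    closure_minimal (Set.image_mono ball_subset_closedBall) hcomp.isClosed
  have hsymm : ∀ z ∈ closedBall z₀ r, e.symm (e z) = z := fun z hz => e.left_inv (hcs hz)
  -- The comparison is moved to the image of the disc under the local inverse: `h ∘ e.symm` is
  -- harmonic because `e.symm` is analytic.
  have key := hu (e '' ball z₀ r) hopen (hcomp.of_isClosed_subset isClosed_closure hcl) ?_
    (fun w => h (e.symm w)) ?_ ?_ ?_ (e z₀) ⟨z₀, mem_ball_self hr, rfl⟩
  · rwa [hsymm z₀ (mem_closedBall_self hr.le)] at key
  · refine hcl.trans ?_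
    rintro _ ⟨z, hz, rfl⟩
    exact (hball z (hcb hz)).2.1
  · refine (hh.comp (e.continuousOn_symm.mono ?_) ?_).mono hcl
    · rintro _ ⟨z, hz, rfl⟩
      exact e.map_source (hcs hz)
    · rintro _ ⟨z, hz, rfl⟩
      rwa [hsymm z hz]
  · rintro _ ⟨z, hz, rfl⟩
    have hzc := ball_subset_closedBall hz
    obtain ⟨hzs, -, hfz, hfz'⟩ := hball z (hcb hzc)
    have hz' : e.symm (e z) = z := hsymm z hzc
    have han : AnalyticAt ℂ e.symm (e z) := by
      refine ContDiffAt.analyticAt (e.contDiffAt_symm_deriv (n := ⊤) hfz' (e.map_source hzs) ?_ ?_)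
      · rw [hz']
        exact hfz.differentiableAt.hasDerivAt
      · rw [hz']
        exact hfz.contDiffAt
    refine HarmonicAt.comp_analyticAt ?_ han
    rw [hz']
    exact hharm z hz
  · rintro w ⟨hw1, hw2⟩
    rw [hopen.interior_eq] at hw2
    obtain ⟨z, hz, rfl⟩ := hcl hw1
    have hzs : z ∈ sphere z₀ r := by
      refine mem_sphere.2 (le_antisymm hz (not_lt.1 fun hlt => hw2 ⟨z, hlt, rfl⟩))
    rw [hsymm z hz]
    exact hle z hzs

theorem upperSemicontinuousOn_comp {X Y : Type*} [TopologicalSpace X] [TopologicalSpace Y]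
    {u : Y → EReal} {f : X → Y} {U : Set Y} {V : Set X}
    (husc : UpperSemicontinuousOn u U) (hf : ContinuousOn f V) (hm : Set.MapsTo f V U) :
    UpperSemicontinuousOn (u ∘ f) V :=
  fun z hz => (husc (f z) (hm hz)).comp (hf z hz) hm

/-- The composition of a subharmonic function with a holomorphic function on a domain is subharmonic
or identically `-∞`. -/
theorem IsSubharmonicOn.comp_holomorphic {u : ℂ → EReal} {U V : Set ℂ} (hu : IsSubharmonicOn u U)
    (hU : IsOpen U) (hV : IsOpen V) (hVc : IsPreconnected V) {f : ℂ → ℂ}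
    (hf : DifferentiableOn ℂ f V) (hm : Set.MapsTo f V U) :
    (∀ z ∈ V, u (f z) = ⊥) ∨ IsSubharmonicOn (u ∘ f) V := by
  by_cases hbot : ∀ z ∈ V, u (f z) = ⊥
  · exact Or.inl hbot
  right
  push Not at hbot
  obtain ⟨b, hbV, hb⟩ := hbot
  have husc : UpperSemicontinuousOn (u ∘ f) V :=
    upperSemicontinuousOn_comp hu.upperSemicontinuousOn hf.continuousOn hm
  have htop : ∀ z ∈ V, (u ∘ f) z ≠ ⊤ := fun z hz => hu.ne_top _ (hm hz)
  refine ⟨husc, htop, fun z hz => ⟨b, ?_, hb⟩, ?_⟩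
  · rwa [hVc.connectedComponentIn hz]
  have han : ∀ z ∈ V, AnalyticAt ℂ f z := fun z hz => hf.analyticAt (hV.mem_nhds hz)
  have hdom : IsDominated u U := hu.le_of_le_frontier
  refine isDominated_of_isCenterDominated husc htop fun z₀ hz₀ => ?_
  -- Either `f` is constant on `V`, with the value `f b` at which `u` is finite, or `z₀` is at worst
  -- an isolated critical point, removable because `f` is conformal around it.
  rcases (han z₀ hz₀).deriv.eventually_eq_zero_or_eventually_ne_zero with h0 | h0
  · have hzero : Set.EqOn (deriv f) 0 V :=
      AnalyticOnNhd.eqOn_of_preconnected_of_eventuallyEq (fun z hz => (han z hz).deriv)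
        (fun z _ => analyticAt_const) hVc hz₀ h0
    obtain ⟨t, ht⟩ : ∃ t : ℝ, u (f b) = t :=
      ⟨_, (EReal.coe_toReal (htop b hbV) hb).symm⟩
    refine HarmonicAt.isCenterDominated (g := fun _ => t) (harmonicAt_const t) ?_
    filter_upwards [hV.mem_nhds hz₀] with z hz
    rw [Function.comp_apply, hV.is_const_of_deriv_eq_zero hVc hf hzero hz hbV, ht]
  · rw [eventually_nhdsWithin_iff] at h0
    obtain ⟨R, hR, hball⟩ := Metric.eventually_nhds_iff_ball.1 (h0.and (hV.mem_nhds hz₀))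
    have hbV' : ball z₀ R ⊆ V := fun z hz => (hball z hz).2
    refine isCenterDominated_of_punctured hR ?_ (husc.mono hbV') (htop z₀ hz₀) ?_
    · have hsub : ball z₀ R \ {z₀} ⊆ V := Set.sdiff_subset.trans hbV'
      refine isDominated_of_isCenterDominated (husc.mono hsub) (fun z hz => htop z (hsub hz))
        fun z hz => ?_
      exact hdom.comp_of_deriv_ne_zero (hU.mem_nhds (hm (hsub hz))) (han z (hsub hz))
        ((hball z hz.1).1 hz.2)
    · intro hcon
      have hfreq := (hdom.isCenterDominated (hU.mem_nhds (hm hz₀))).frequently_le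
        hu.upperSemicontinuousOn (hU.mem_nhds (hm hz₀))
      refine hfreq ?_
      rw [eventually_nhdsWithin_iff] at hcon ⊢
      -- By the open mapping theorem, the points near `f z₀` where `u` is at least `u (f z₀)` have
      -- preimages near `z₀`.
      rcases (han z₀ hz₀).eventually_constant_or_nhds_le_map_nhds with hc | hc
      · have : ∀ᶠ z in 𝓝[≠] z₀, deriv f z = 0 := by
          refine (hc.eventually_nhds.mono fun z hz => ?_).filter_mono nhdsWithin_le_nhds
          have : f =ᶠ[𝓝 z] fun _ => f z₀ := hz
          rw [this.deriv_eq, deriv_const]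
        rw [← eventually_nhdsWithin_iff] at h0
        obtain ⟨z, hz1, hz2⟩ := (this.and h0).exists
        exact absurd hz1 hz2
      · refine hc ?_
        rw [mem_map]
        filter_upwards [hcon] with z hz hne
        exact hz fun h => hne (by rw [h]; rfl)

theorem IsSubharmonicOn.congr {u v : ℂ → EReal} {U : Set ℂ} (hu : IsSubharmonicOn u U)
    (huv : Set.EqOn u v U) : IsSubharmonicOn v U where
  upperSemicontinuousOn := fun z hz y hy => by
    filter_upwards [hu.upperSemicontinuousOn z hz y (by simpa only [huv hz] using hy), self_mem_nhdsWithin]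
      with w hw hwU
    simpa only [← huv hwU] using hw
  ne_top z hz := huv hz ▸ hu.ne_top z hz
  exists_ne_bot z hz := by
    obtain ⟨w, hw, hwb⟩ := hu.exists_ne_bot z hz
    exact ⟨w, hw, huv (connectedComponentIn_subset U z hw) ▸ hwb⟩
  le_of_le_frontier G hG hGc hGU h hh hharm hfr z hz := by
    rw [← huv (hGU (subset_closure hz))]
    refine hu.le_of_le_frontier G hG hGc hGU h hh hharm (fun w hw => ?_) z hz
    rw [huv (hGU (frontier_subset_closure hw))]
    exact hfr w hw

/-! ### The logarithmic pole and the complex Green function -/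

/-- The function `log (|z - a| / R)`, with value `-∞` at `a`. -/
def logPole (a : ℂ) (R : ℝ) (z : ℂ) : EReal :=
  -- The value at `a` is prescribed because `Real.log 0 = 0`.
  open Classical in if z = a then ⊥ else ((Real.log ‖z - a‖ - Real.log R : ℝ) : EReal)

theorem logPole_self (a : ℂ) (R : ℝ) : logPole a R a = ⊥ := by simp [logPole]

theorem logPole_of_ne {a z : ℂ} (R : ℝ) (h : z ≠ a) :
    logPole a R z = ((Real.log ‖z - a‖ - Real.log R : ℝ) : EReal) := by simp [logPole, h]

theorem continuousAt_logPole_real {a z : ℂ} (R : ℝ) (h : z ≠ a) :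
    ContinuousAt (fun w : ℂ => Real.log ‖w - a‖ - Real.log R) z :=
  ((continuousOn_log_norm_sub a).continuousAt (isOpen_compl_singleton.mem_nhds h)).sub
    continuousAt_const

theorem logPole_eventuallyEq {a z : ℂ} (R : ℝ) (h : z ≠ a) :
    ∀ᶠ w in 𝓝 z, logPole a R w = ((Real.log ‖w - a‖ - Real.log R : ℝ) : EReal) := by
  filter_upwards [isOpen_compl_singleton.mem_nhds h] with w hw
  exact logPole_of_ne R hw

theorem tendsto_log_norm_sub_atBot (a : ℂ) :
    Tendsto (fun z : ℂ => Real.log ‖z - a‖) (𝓝[≠] a) atBot :=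
  Real.tendsto_log_nhdsGT_zero.comp (tendsto_norm_sub_self_nhdsNE a)

theorem upperSemicontinuous_logPole (a : ℂ) (R : ℝ) : UpperSemicontinuous (logPole a R) := by
  intro z y hy
  by_cases hz : z = a
  · subst hz
    rw [logPole_self] at hy
    obtain ⟨t, -, ht⟩ := EReal.lt_iff_exists_real_btwn.1 hy
    have h1 := (tendsto_log_norm_sub_atBot z).eventually_lt_atBot (t + Real.log R)
    rw [eventually_nhdsWithin_iff] at h1
    filter_upwards [h1] with w hw
    by_cases hwz : w = z
    · rw [hwz, logPole_self]; exact hy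
    · rw [logPole_of_ne R hwz]
      refine lt_trans ?_ ht
      exact_mod_cast sub_lt_iff_lt_add.2 (hw hwz)
  · have h1 : ContinuousAt (logPole a R) z :=
      (continuous_coe_real_ereal.continuousAt.comp (continuousAt_logPole_real R hz)).congr
        ((logPole_eventuallyEq R hz).mono fun w hw => hw.symm)
    exact h1.eventually (gt_mem_nhds hy)

theorem isSubharmonicOn_logPole {U : Set ℂ} (hU : IsOpen U) (a : ℂ) (R : ℝ) :
    IsSubharmonicOn (logPole a R) U := by
  have htop : ∀ z ∈ U, logPole a R z ≠ ⊤ := fun z _ => by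
    by_cases hz : z = a
    · rw [hz, logPole_self]; exact bot_ne_top
    · rw [logPole_of_ne R hz]; exact EReal.coe_ne_top _
  have husc := (upperSemicontinuous_logPole a R).upperSemicontinuousOn U
  refine ⟨husc, htop, fun z hz => ?_, isDominated_of_isCenterDominated husc htop fun z _ => ?_⟩
  · have hC : connectedComponentIn U z ∈ 𝓝 z :=
      hU.connectedComponentIn.mem_nhds (mem_connectedComponentIn hz)
    by_cases hza : z = a
    · obtain ⟨w, hw, hne⟩ :=
        (Filter.Eventually.and (p := fun w => w ∈ connectedComponentIn U z)
          (mem_nhdsWithin_of_mem_nhds hC) (self_mem_nhdsWithin (s := {z}ᶜ))).exists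
      refine ⟨w, hw, ?_⟩
      rw [logPole_of_ne R (hza ▸ hne)]
      exact EReal.coe_ne_bot _
    · exact ⟨z, mem_connectedComponentIn hz, by rw [logPole_of_ne R hza]; exact EReal.coe_ne_bot _⟩
  · by_cases hza : z = a
    · exact isCenterDominated_of_eq_bot (by rw [hza, logPole_self])
    · exact HarmonicAt.isCenterDominated
        ((harmonicAt_log_norm_sub hza).sub (harmonicAt_const _)) (logPole_eventuallyEq R hza)

theorem ereal_sub_coe_le_iff (x : EReal) (b c : ℝ) :
    x - (b : EReal) ≤ (c : EReal) ↔ x ≤ ((b + c : ℝ) : EReal) := by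
  rw [EReal.sub_le_iff_le_add (by simp) (by simp), add_comm b c, EReal.coe_add]

theorem limsup_sub_log_lt_top {u : ℂ → EReal} {U : Set ℂ} {a : ℂ} {C : ℝ}
    (h : ∀ᶠ z in 𝓝[≠] a, u z ≤ ((Real.log ‖z - a‖ + C : ℝ) : EReal)) :
    limsup (fun z => u z - (Real.log ‖z - a‖ : EReal)) (𝓝[U \ {a}] a) < ⊤ := by
  refine lt_of_le_of_lt (limsup_le_of_le (by isBoundedDefault) (a := (C : EReal)) ?_)
    (EReal.coe_lt_top C)
  refine (h.filter_mono (nhdsWithin_mono a fun z hz => hz.2)).mono fun z hz => ?_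
  rwa [ereal_sub_coe_le_iff]

/-- This competitor shows that the class is nonempty and bounds the Green function below; negativity
comes from the enclosing disc. -/
theorem logPole_mem {U : Set ℂ} (hU : IsOpen U) {a : ℂ} {R : ℝ} (hUR : U ⊆ ball a R) :
    logPole a R ∈ negSubharmonicWithPole U a := by
  refine ⟨isSubharmonicOn_logPole hU a R, fun z hz => ?_, limsup_sub_log_lt_top (C := -Real.log R) ?_⟩
  · by_cases hza : z = a
    · rw [hza, logPole_self]; exact EReal.bot_lt_zero
    · rw [logPole_of_ne R hza]
      have : Real.log ‖z - a‖ < Real.log R :=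
        Real.log_lt_log (norm_pos_iff.2 (sub_ne_zero.2 hza)) (mem_ball_iff_norm.1 (hUR hz))
      exact_mod_cast sub_neg.2 this
  · filter_upwards [self_mem_nhdsWithin] with z hz
    rw [logPole_of_ne R hz, sub_eq_add_neg]

/-- Each competitor lies below `log (|z - a| / r)` on each disc of radius `r` about the pole. -/
theorem le_log_of_mem_negSubharmonicWithPole {U : Set ℂ} {a : ℂ} {u : ℂ → EReal}
    (hu : u ∈ negSubharmonicWithPole U a) {r : ℝ} (hr : closedBall a r ⊆ U) {z : ℂ}
    (hz : z ∈ ball a r) (hza : z ≠ a) :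
    u z ≤ ((Real.log ‖z - a‖ - Real.log r : ℝ) : EReal) := by
  obtain ⟨hsub, hneg, hlim⟩ := hu
  have hrpos : 0 < r := pos_of_mem_ball hz
  have hU : U ∈ 𝓝 a := mem_of_superset (closedBall_mem_nhds a hrpos) hr
  obtain ⟨C, hC, -⟩ := EReal.lt_iff_exists_real_btwn.1 hlim
  have h1 := eventually_lt_of_limsup_lt hC
  have h2 : 𝓝[U \ {a}] a = 𝓝[≠] a := by
    rw [Set.sdiff_eq]
    exact nhdsWithin_inter_of_mem (mem_nhdsWithin_of_mem_nhds hU)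
  rw [h2] at h1
  have hdom : IsDominated u U := hsub.le_of_le_frontier
  -- The majorant vanishes on the circle, where `u < 0`; near `a` the pole condition bounds the
  -- excess by `C + log r`.
  refine hdom.le_on_punctured (c := a) (r := r) (Set.sdiff_subset.trans hr)
    (h := fun z => Real.log ‖z - a‖ - Real.log r) (A := C + Real.log r) ?_ ?_ ?_ ?_ ⟨hz, hza⟩
  · exact fun w hw => (continuousAt_logPole_real r hw.2).continuousWithinAt
  · exact fun w hw => (harmonicAt_log_norm_sub hw.2).sub (harmonicAt_const _)
  · intro w hw
    have : ‖w - a‖ = r := by simpa [dist_eq_norm] using hw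
    simpa [this] using (hneg w (hr (sphere_subset_closedBall hw))).le
  · filter_upwards [h1] with w hw
    have := (ereal_sub_coe_le_iff _ _ _).1 hw.le
    refine this.trans_eq ?_
    congr 1
    ring

theorem le_complexGreen {U : Set ℂ} {a : ℂ} {u : ℂ → EReal}
    (hu : u ∈ negSubharmonicWithPole U a) (z : ℂ) : u z ≤ complexGreen U a z :=
  le_iSup₂ (f := fun (u : ℂ → EReal) (_ : u ∈ negSubharmonicWithPole U a) => u z) u hu

theorem complexGreen_le_log {U : Set ℂ} {a : ℂ} {r : ℝ} (hr : closedBall a r ⊆ U) {z : ℂ}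
    (hz : z ∈ ball a r) (hza : z ≠ a) :
    complexGreen U a z ≤ ((Real.log ‖z - a‖ - Real.log r : ℝ) : EReal) :=
  iSup₂_le fun _ hu => le_log_of_mem_negSubharmonicWithPole hu hr hz hza

theorem log_le_complexGreen {U : Set ℂ} (hU : IsOpen U) {a : ℂ} {R : ℝ} (hUR : U ⊆ ball a R)
    {z : ℂ} (hza : z ≠ a) :
    ((Real.log ‖z - a‖ - Real.log R : ℝ) : EReal) ≤ complexGreen U a z :=
  logPole_of_ne R hza ▸ le_complexGreen (logPole_mem hU hUR) z

theorem limsup_nhds_le_of_eventually_le {g : ℂ → EReal} {h : ℂ → ℝ} {z : ℂ}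
    (hh : ContinuousAt h z) (hle : ∀ᶠ w in 𝓝 z, g w ≤ (h w : EReal)) :
    limsup g (𝓝 z) ≤ (h z : EReal) := by
  have h1 : Tendsto (fun w => (h w : EReal)) (𝓝 z) (𝓝 (h z : EReal)) :=
    continuous_coe_real_ereal.continuousAt.comp hh
  exact (limsup_le_limsup hle).trans_eq h1.limsup_eq

theorem le_limsup_nhds (g : ℂ → EReal) (z : ℂ) : g z ≤ limsup g (𝓝 z) :=
  le_limsup_of_frequently_le (Frequently.filter_mono (f := pure z) (by simp) (pure_le_nhds z))

theorem upperSemicontinuous_limsup_nhds (g : ℂ → EReal) :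
    UpperSemicontinuous fun z => limsup g (𝓝 z) := by
  intro z y hy
  obtain ⟨t, ht1, ht2⟩ := exists_between hy
  filter_upwards [(eventually_lt_of_limsup_lt ht1).eventually_nhds] with w hw
  exact lt_of_le_of_lt (limsup_le_of_le (by isBoundedDefault) (hw.mono fun _ h => h.le)) ht2

/-- The upper semicontinuous regularization of the complex Green function of a bounded domain
belongs to the class defining the Green function. -/
theorem limsup_complexGreen_mem {U : Set ℂ} (hU : IsOpen U) (hUc : IsPreconnected U)
    (hb : Bornology.IsBounded U) {a : ℂ} (ha : a ∈ U) :
    (fun z => limsup (complexGreen U a) (𝓝 z)) ∈ negSubharmonicWithPole U a := by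
  set g : ℂ → EReal := fun z => limsup (complexGreen U a) (𝓝 z) with hg
  obtain ⟨R, -, hUR⟩ := hb.subset_ball_lt 0 a
  obtain ⟨r, hr, hrU⟩ := Metric.nhds_basis_closedBall.mem_iff.1 (hU.mem_nhds ha)
  have hle0 : ∀ z ∈ U, g z ≤ 0 := by
    intro z hz
    refine limsup_le_of_le (by isBoundedDefault) ?_
    filter_upwards [hU.mem_nhds hz] with w hw
    exact iSup₂_le fun u hu => (hu.2.1 w hw).le
  have hlog : ∀ z ∈ ball a r, z ≠ a → g z ≤ ((Real.log ‖z - a‖ - Real.log r : ℝ) : EReal) := by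
    intro z hz hza
    refine limsup_nhds_le_of_eventually_le (continuousAt_logPole_real r hza) ?_
    filter_upwards [isOpen_ball.mem_nhds hz, isOpen_compl_singleton.mem_nhds hza] with w hw hwa
    exact complexGreen_le_log hrU hw hwa
  have husc : UpperSemicontinuousOn g U :=
    (upperSemicontinuous_limsup_nhds _).upperSemicontinuousOn U
  -- On the frontier each competitor is below `g`, hence below `h`. The resulting bound inside `G`
  -- is uniform over competitors, and continuity of `h` carries it to the limsup.
  have hdom : IsDominated g U := by
    intro G hG hGc hGU h hh hharm hfr z hz
    refine limsup_nhds_le_of_eventually_le (hh.continuousAt (mem_of_superset (hG.mem_nhds hz)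
      subset_closure)) ?_
    filter_upwards [hG.mem_nhds hz] with w hw
    refine iSup₂_le fun u hu => hu.1.le_of_le_frontier G hG hGc hGU h hh hharm (fun y hy => ?_) w hw
    exact (le_complexGreen hu y).trans ((le_limsup_nhds _ y).trans (hfr y hy))
  have hpunct : ∀ᶠ z in 𝓝[≠] a, z ∈ ball a r ∧ z ≠ a :=
    Filter.Eventually.and (p := fun z => z ∈ ball a r)
      (mem_nhdsWithin_of_mem_nhds (ball_mem_nhds a hr)) self_mem_nhdsWithin
  refine ⟨⟨husc, fun z hz => ne_top_of_le_ne_top EReal.zero_ne_top (hle0 z hz), fun z hz => ?_,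
    hdom⟩, ?_, ?_⟩
  · obtain ⟨w, hw, hwb⟩ := (logPole_mem hU hUR).1.exists_ne_bot z hz
    refine ⟨w, hw, fun h => hwb (le_bot_iff.1 ?_)⟩
    rw [← h]
    exact (le_complexGreen (logPole_mem hU hUR) w).trans (le_limsup_nhds _ w)
  -- Regularization only preserves `≤ 0`; strictness comes from the strong maximum principle, with a
  -- negative value found near the pole.
  · refine hdom.neg_of_exists_neg hU hUc husc hle0 ?_
    obtain ⟨z, hz, hza⟩ := hpunct.exists
    refine ⟨z, hrU (ball_subset_closedBall hz), (hlog z hz hza).trans_lt ?_⟩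
    have : Real.log ‖z - a‖ < Real.log r :=
      Real.log_lt_log (norm_pos_iff.2 (sub_ne_zero.2 hza)) (mem_ball_iff_norm.1 hz)
    exact_mod_cast sub_neg.2 this
  · refine limsup_sub_log_lt_top (C := -Real.log r) ?_
    filter_upwards [hpunct] with z hz
    simpa only [sub_eq_add_neg] using hlog z hz.1 hz.2

/-- The complex Green function of a bounded domain is one of its own competitors. -/
theorem complexGreen_mem {U : Set ℂ} (hU : IsOpen U) (hUc : IsPreconnected U)
    (hb : Bornology.IsBounded U) {a : ℂ} (ha : a ∈ U) :
    complexGreen U a ∈ negSubharmonicWithPole U a := by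
  have hmem := limsup_complexGreen_mem hU hUc hb ha
  have heq : (fun z => limsup (complexGreen U a) (𝓝 z)) = complexGreen U a :=
    funext fun z => le_antisymm (le_complexGreen hmem z) (le_limsup_nhds _ z)
  rwa [heq] at hmem

/-! ### Conjugation symmetry of the Green function -/

theorem negSubharmonicWithPole_comp_conj {U : Set ℂ} (hUconj : ∀ z ∈ U, (starRingEnd ℂ) z ∈ U)
    (hUc : IsPreconnected U) {x : ℝ} {u : ℂ → EReal}
    (hu : u ∈ negSubharmonicWithPole U x) :
    u ∘ starRingEnd ℂ ∈ negSubharmonicWithPole U x := by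
  obtain ⟨hsub, hneg, hlim⟩ := hu
  have hm : Set.MapsTo (starRingEnd ℂ) U U := hUconj
  refine ⟨⟨upperSemicontinuousOn_comp hsub.upperSemicontinuousOn
    Complex.continuous_conj.continuousOn hm, fun z hz => hsub.ne_top _ (hm hz), fun z hz => ?_,
    IsDominated.comp_conj hsub.le_of_le_frontier hm⟩, fun z hz => hneg _ (hm hz), ?_⟩
  · obtain ⟨w, hw, hwb⟩ := hsub.exists_ne_bot z hz
    rw [hUc.connectedComponentIn hz] at hw ⊢
    exact ⟨(starRingEnd ℂ) w, hm hw, by simpa using hwb⟩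
  · have h1 : Tendsto (starRingEnd ℂ) (𝓝[U \ {(x : ℂ)}] x) (𝓝[U \ {(x : ℂ)}] x) := by
      refine tendsto_nhdsWithin_iff.2 ⟨?_, ?_⟩
      · have := Complex.continuous_conj.tendsto (x : ℂ)
        rw [Complex.conj_ofReal] at this
        exact this.mono_left nhdsWithin_le_nhds
      · filter_upwards [self_mem_nhdsWithin] with z hz
        refine ⟨hm hz.1, fun h => hz.2 ?_⟩
        have h' : (starRingEnd ℂ) z = x := h
        rw [Set.mem_singleton_iff, ← Complex.conj_conj z, h', Complex.conj_ofReal]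
    refine lt_of_le_of_lt ?_ hlim
    refine le_trans (le_of_eq ?_) (limsup_le_limsup_of_le h1)
    rw [← limsup_comp]
    congr 1
    funext z
    have : ‖(starRingEnd ℂ) z - x‖ = ‖z - x‖ := by
      rw [← Complex.norm_conj (z - x), map_sub, Complex.conj_ofReal]
    simp [this]

/-- Conjugation fixes the real pole and preserves distances to it, so it maps competitors to
competitors; being an involution, it turns one inequality into equality. -/
theorem complexGreen_conj {U : Set ℂ} (hUconj : ∀ z ∈ U, (starRingEnd ℂ) z ∈ U)
    (hUc : IsPreconnected U) (x : ℝ) (z : ℂ) :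
    complexGreen U x ((starRingEnd ℂ) z) = complexGreen U x z := by
  have key : ∀ w, complexGreen U x w ≤ complexGreen U x ((starRingEnd ℂ) w) := fun w =>
    iSup₂_le fun u hu => by
      simpa using
        le_complexGreen (negSubharmonicWithPole_comp_conj hUconj hUc hu) ((starRingEnd ℂ) w)
  refine le_antisymm ?_ (key z)
  simpa using key ((starRingEnd ℂ) z)

theorem _root_.UpperSemicontinuousOn.congr_eqOn {X : Type*} [TopologicalSpace X] {u v : X → EReal}
    {s : Set X} (hu : UpperSemicontinuousOn u s) (huv : Set.EqOn u v s) :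
    UpperSemicontinuousOn v s := fun z hz y hy => by
  filter_upwards [hu z hz y (by simpa only [huv hz] using hy), self_mem_nhdsWithin] with w hw hws
  simpa only [← huv hws] using hw

/-! ### Quaternionic slices and the folding map -/

/-- The point `x + i |y|` of the closed upper half plane associated with `x + I y`. -/
def toHalf (q : ℍ[ℝ]) : ℂ := ⟨q.re, ‖q.im‖⟩

theorem norm_sq_eq (q : ℍ[ℝ]) : ‖q‖ ^ 2 = q.re ^ 2 + q.imI ^ 2 + q.imJ ^ 2 + q.imK ^ 2 := by
  rw [sq, ← Quaternion.normSq_eq_norm_mul_self, Quaternion.normSq_def']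

theorem norm_im_sq_eq (q : ℍ[ℝ]) : ‖q.im‖ ^ 2 = q.imI ^ 2 + q.imJ ^ 2 + q.imK ^ 2 := by
  rw [norm_sq_eq]; simp

theorem re_of_mem_imUnits {I : ℍ[ℝ]} (hI : I ∈ imUnits) : I.re = 0 := by
  have h : I * I = -1 := hI
  have h0 := congrArg QuaternionAlgebra.re h
  have h1 := congrArg QuaternionAlgebra.imI h
  have h2 := congrArg QuaternionAlgebra.imJ h
  have h3 := congrArg QuaternionAlgebra.imK h
  simp at h0 h1 h2 h3
  by_contra hne
  have e1 : I.imI = 0 := mul_left_cancel₀ hne (by linarith)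
  have e2 : I.imJ = 0 := mul_left_cancel₀ hne (by linarith)
  have e3 : I.imK = 0 := mul_left_cancel₀ hne (by linarith)
  rw [e1, e2, e3] at h0
  nlinarith [mul_self_nonneg I.re]

theorem norm_of_mem_imUnits {I : ℍ[ℝ]} (hI : I ∈ imUnits) : ‖I‖ = 1 := by
  have h : I * I = -1 := hI
  have h1 : ‖I‖ * ‖I‖ = 1 := by rw [← norm_mul, h, norm_neg, norm_one]
  nlinarith [norm_nonneg I]

theorem sum_sq_of_mem_imUnits {I : ℍ[ℝ]} (hI : I ∈ imUnits) :
    I.imI ^ 2 + I.imJ ^ 2 + I.imK ^ 2 = 1 := by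
  have := norm_sq_eq I
  rw [norm_of_mem_imUnits hI, re_of_mem_imUnits hI] at this
  linarith

theorem mem_imUnits_of_re_of_sum {I : ℍ[ℝ]} (h0 : I.re = 0)
    (h1 : I.imI ^ 2 + I.imJ ^ 2 + I.imK ^ 2 = 1) : I ∈ imUnits := by
  change I * I = -1
  ext <;> simp [h0] <;> linarith

theorem unitI_mem : unitI ∈ imUnits := mem_imUnits_of_re_of_sum rfl (by simp [unitI])

theorem neg_mem_imUnits {I : ℍ[ℝ]} (hI : I ∈ imUnits) : -I ∈ imUnits := by
  change -I * -I = -1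
  rw [neg_mul_neg]; exact hI

theorem continuous_toSlice (I : ℍ[ℝ]) : Continuous (toSlice I) :=
  (Quaternion.continuous_coe.comp Complex.continuous_re).add
    (continuous_const.mul (Quaternion.continuous_coe.comp Complex.continuous_im))

theorem toSlice_ofReal (I : ℍ[ℝ]) (x : ℝ) : toSlice I (x : ℂ) = (x : ℍ[ℝ]) := by
  simp [toSlice]

theorem toSlice_sub_ofReal (I : ℍ[ℝ]) (z : ℂ) (x : ℝ) :
    toSlice I z - (x : ℍ[ℝ]) = toSlice I (z - x) := by
  simp [toSlice]; abel

theorem norm_toSlice {I : ℍ[ℝ]} (hI : I ∈ imUnits) (z : ℂ) : ‖toSlice I z‖ = ‖z‖ := by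
  rw [← sq_eq_sq₀ (norm_nonneg _) (norm_nonneg _), norm_sq_eq, ← Complex.normSq_eq_norm_sq,
    Complex.normSq_apply]
  have h := sum_sq_of_mem_imUnits hI
  simp [toSlice, re_of_mem_imUnits hI]
  linear_combination z.im ^ 2 * h

theorem toSlice_conj (I : ℍ[ℝ]) (z : ℂ) : toSlice I ((starRingEnd ℂ) z) = toSlice (-I) z := by
  simp [toSlice]

theorem continuous_toHalf : Continuous toHalf := by
  have : toHalf = fun q : ℍ[ℝ] => (q.re : ℂ) + (‖q.im‖ : ℂ) * Complex.I :=
    funext fun q => Complex.mk_eq_add_mul_I _ _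
  rw [this]
  have h1 := Quaternion.continuous_re
  have h2 := Quaternion.continuous_im
  fun_prop

/-- Off the real axis `I = Im q / |Im q|`; on it every unit works and `unitI` is picked. -/
theorem exists_toSlice_toHalf (q : ℍ[ℝ]) : ∃ I ∈ imUnits, toSlice I (toHalf q) = q := by
  by_cases hq : q.im = 0
  · refine ⟨unitI, unitI_mem, ?_⟩
    rw [toSlice, toHalf, hq]
    simpa [hq] using Quaternion.re_add_im q
  · have hn : ‖q.im‖ ≠ 0 := norm_ne_zero_iff.2 hq
    refine ⟨‖q.im‖⁻¹ • q.im, mem_imUnits_of_re_of_sum (by simp) ?_, ?_⟩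
    · have := norm_im_sq_eq q
      simp
      field_simp
      linarith
    · have h1 : (‖q.im‖⁻¹ • q.im) * ((‖q.im‖ : ℝ) : ℍ[ℝ]) = q.im := by
        rw [Quaternion.mul_coe_eq_smul, smul_smul, mul_inv_cancel₀ hn, one_smul]
      rw [toSlice, toHalf, h1]
      exact Quaternion.re_add_im q

theorem toHalf_toSlice {I : ℍ[ℝ]} (hI : I ∈ imUnits) (z : ℂ) :
    toHalf (toSlice I z) = ⟨z.re, |z.im|⟩ := by
  have h1 : ‖(toSlice I z).im‖ = |z.im| := by
    rw [← sq_eq_sq₀ (norm_nonneg _) (abs_nonneg _), norm_im_sq_eq, sq_abs]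
    have h := sum_sq_of_mem_imUnits hI
    simp [toSlice]
    linear_combination z.im ^ 2 * h
  rw [toHalf, h1]
  simp [toSlice, re_of_mem_imUnits hI]

/-- Folding preserves distances to real points, so logarithmic poles at `x` in `ℍ` and in `ℂ`
correspond. -/
theorem norm_toHalf_sub (q : ℍ[ℝ]) (x : ℝ) : ‖toHalf q - x‖ = ‖q - (x : ℍ[ℝ])‖ := by
  obtain ⟨I, hI, hq⟩ := exists_toSlice_toHalf q
  rw [← norm_toSlice hI, ← toSlice_sub_ofReal, hq]

section Slices

variable {Ω : Set ℍ[ℝ]}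

theorem slice_eq (hsymm : IsAxiallySymmetric Ω) {I J : ℍ[ℝ]} (hI : I ∈ imUnits)
    (hJ : J ∈ imUnits) : slice Ω I = slice Ω J :=
  Set.ext fun z => ⟨hsymm z.re z.im I hI J hJ, hsymm z.re z.im J hJ I hI⟩

theorem isOpen_slice (hΩ : IsOpen Ω) (I : ℍ[ℝ]) : IsOpen (slice Ω I) :=
  hΩ.preimage (continuous_toSlice I)

theorem conj_mem_slice (hsymm : IsAxiallySymmetric Ω) {I : ℍ[ℝ]} (hI : I ∈ imUnits) {z : ℂ}
    (hz : z ∈ slice Ω I) : (starRingEnd ℂ) z ∈ slice Ω I := by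
  rw [slice, Set.mem_preimage, toSlice_conj]
  exact hsymm z.re z.im I hI (-I) (neg_mem_imUnits hI) hz

theorem isBounded_slice (hΩ : Bornology.IsBounded Ω) {I : ℍ[ℝ]} (hI : I ∈ imUnits) :
    Bornology.IsBounded (slice Ω I) := by
  obtain ⟨C, hC⟩ := isBounded_iff_forall_norm_le.1 hΩ
  exact isBounded_iff_forall_norm_le.2 ⟨C, fun z hz => norm_toSlice hI z ▸ hC _ hz⟩

/-- Connectedness is assumed for a subset of `ℍ`; the continuous left inverse `q ↦ (q.re, q.imI)` of
`toSlice unitI` carries it to `ℂ`. -/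
theorem isPreconnected_slice_unitI (hΩ : IsSliceDomain Ω) :
    IsPreconnected (slice Ω unitI) := by
  have hinv : ∀ z : ℂ, (⟨(toSlice unitI z).re, (toSlice unitI z).imI⟩ : ℂ) = z := fun z => by
    have h0 : unitI.re = 0 := rfl
    have h1 : unitI.imI = 1 := rfl
    apply Complex.ext <;> simp [toSlice, h0, h1]
  have hcont : Continuous fun q : ℍ[ℝ] => (⟨q.re, q.imI⟩ : ℂ) := by
    have : (fun q : ℍ[ℝ] => (⟨q.re, q.imI⟩ : ℂ)) =
        fun q : ℍ[ℝ] => (q.re : ℂ) + (q.imI : ℂ) * Complex.I :=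
      funext fun q => Complex.mk_eq_add_mul_I _ _
    rw [this]
    have h1 := Quaternion.continuous_re
    have h2 := Quaternion.continuous_imI
    fun_prop
  have := (hΩ.isConnected_slice unitI unitI_mem).isPreconnected.image _ hcont.continuousOn
  convert this
  ext z
  constructor
  · exact fun hz => ⟨toSlice unitI z, ⟨hz, z, rfl⟩, hinv z⟩
  · rintro ⟨_, ⟨hq, w, rfl⟩, rfl⟩
    exact Set.mem_of_eq_of_mem (hinv w) hq

theorem toHalf_mem_slice (hsymm : IsAxiallySymmetric Ω) {q : ℍ[ℝ]} (hq : q ∈ Ω) :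
    toHalf q ∈ slice Ω unitI := by
  obtain ⟨I, hI, hqI⟩ := exists_toSlice_toHalf q
  rw [slice_eq hsymm unitI_mem hI, slice, Set.mem_preimage, hqI]
  exact hq

theorem IsSpread.apply_toSlice {γ : ℂ → EReal} {u : ℍ[ℝ] → EReal} (hu : IsSpread Ω γ u)
    {I : ℍ[ℝ]} (hI : I ∈ imUnits) {z : ℂ} (hz : z ∈ slice Ω I) : u (toSlice I z) = γ z := by
  have := hu z.re z.im I hI hz
  rwa [Complex.re_add_im] at this

theorem IsSpread.apply_eq {γ : ℂ → EReal} {u : ℍ[ℝ] → EReal} (hu : IsSpread Ω γ u)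
    {q : ℍ[ℝ]} (hq : q ∈ Ω) : u q = γ (toHalf q) := by
  obtain ⟨I, hI, hqI⟩ := exists_toSlice_toHalf q
  have := hu.apply_toSlice hI (z := toHalf q) (by rwa [slice, Set.mem_preimage, hqI])
  rwa [hqI] at this

theorem isSpread_comp_toHalf {γ : ℂ → EReal} (hγ : ∀ z, γ ((starRingEnd ℂ) z) = γ z) :
    IsSpread Ω γ (γ ∘ toHalf) := by
  intro x y I hI _
  have h1 : (x : ℍ[ℝ]) + I * (y : ℍ[ℝ]) = toSlice I ⟨x, y⟩ := rfl
  rw [Function.comp_apply, h1, toHalf_toSlice hI, ← Complex.mk_eq_add_mul_I]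
  rcases abs_cases y with ⟨h, -⟩ | ⟨h, -⟩
  · simp only [h]
  · simp only [h]
    exact hγ ⟨x, y⟩

end Slices

/-! ### Holomorphy of the folding map -/

/-- The real part as a continuous linear map. -/
def reL : ℍ[ℝ] →L[ℝ] ℝ where
  toFun q := q.re
  map_add' _ _ := rfl
  map_smul' _ _ := rfl
  cont := Quaternion.continuous_re

/-- The first imaginary component as a continuous linear map. -/
def imIL : ℍ[ℝ] →L[ℝ] ℝ where
  toFun q := q.imI
  map_add' _ _ := rfl
  map_smul' _ _ := rfl
  cont := Quaternion.continuous_imI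

/-- The second imaginary component as a continuous linear map. -/
def imJL : ℍ[ℝ] →L[ℝ] ℝ where
  toFun q := q.imJ
  map_add' _ _ := rfl
  map_smul' _ _ := rfl
  cont := Quaternion.continuous_imJ

/-- The third imaginary component as a continuous linear map. -/
def imKL : ℍ[ℝ] →L[ℝ] ℝ where
  toFun q := q.imK
  map_add' _ _ := rfl
  map_smul' _ _ := rfl
  cont := Quaternion.continuous_imK

/-- Off the real axis `|Im q|` is the square root of a nonvanishing polynomial. The explicit
derivative, pairing `v` with `Im q / |Im q|`, is what the Cauchy-Riemann check uses. -/
theorem exists_hasFDerivAt_toHalf {q : ℍ[ℝ]} (hq : q.im ≠ 0) :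
    ∃ L : ℍ[ℝ] →L[ℝ] ℂ, HasFDerivAt toHalf L q ∧ ∀ v, L v = ((v.re : ℝ) : ℂ) +
      ((‖q.im‖⁻¹ * (q.imI * v.imI + q.imJ * v.imJ + q.imK * v.imK) : ℝ) : ℂ) * Complex.I := by
  have hn : 0 < ‖q.im‖ := norm_pos_iff.2 hq
  have hsum : q.imI ^ 2 + q.imJ ^ 2 + q.imK ^ 2 ≠ 0 := by
    rw [← norm_im_sq_eq]; positivity
  have hsqrt : ∀ p : ℍ[ℝ], ‖p.im‖ = √(p.imI ^ 2 + p.imJ ^ 2 + p.imK ^ 2) := fun p => by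
    rw [← norm_im_sq_eq, Real.sqrt_sq (norm_nonneg _)]
  have h1 : HasFDerivAt (fun p : ℍ[ℝ] => p.imI ^ 2 + p.imJ ^ 2 + p.imK ^ 2) _ q :=
    ((imIL.hasFDerivAt.pow 2).add (imJL.hasFDerivAt.pow 2)).add (imKL.hasFDerivAt.pow 2)
  have h2 := h1.sqrt hsum
  have h3 := (Complex.ofRealCLM.hasFDerivAt.comp q reL.hasFDerivAt).add
    ((Complex.ofRealCLM.hasFDerivAt.comp q h2).mul_const Complex.I)
  refine ⟨_, h3.congr_of_eventuallyEq (Eventually.of_forall fun p => ?_), fun v => ?_⟩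
  · rw [toHalf, hsqrt]
    exact Complex.mk_eq_add_mul_I _ _
  · rw [hsqrt]
    have : √(q.imI ^ 2 + q.imJ ^ 2 + q.imK ^ 2) ≠ 0 := by rw [← hsqrt]; exact hn.ne'
    have e1 : imIL v = v.imI := rfl
    have e2 : imJL v = v.imJ := rfl
    have e3 : imKL v = v.imK := rfl
    have e4 : reL v = v.re := rfl
    have f1 : imIL q = q.imI := rfl
    have f2 : imJL q = q.imJ := rfl
    have f3 : imKL q = q.imK := rfl
    simp [e1, e2, e3, e4, f1, f2, f3]
    field_simp

theorem mem_realAxis_of_im_eq_zero {q : ℍ[ℝ]} (hq : q.im = 0) : q ∈ realAxis :=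
  ⟨q.re, by simpa [hq] using Quaternion.re_add_im q⟩

/-- The map `x + I y ↦ x + i |y|` is holomorphic on `(ℍ ∖ ℝ, 𝕁)`. -/
theorem IsJHolomorphicOn.differentiableOn_toHalf {φ : ℂ → ℍ[ℝ]} {V : Set ℂ} {W : Set ℍ[ℝ]}
    (hφ : IsJHolomorphicOn φ V W) (hW : Disjoint W realAxis) :
    DifferentiableOn ℂ (toHalf ∘ φ) V := by
  intro z hz
  have him : (φ z).im ≠ 0 := fun h =>
    Set.disjoint_left.1 hW (hφ.mapsTo hz) (mem_realAxis_of_im_eq_zero h)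
  have hn : ‖(φ z).im‖ ≠ 0 := norm_ne_zero_iff.2 him
  obtain ⟨L, hL, hLv⟩ := exists_hasFDerivAt_toHalf him
  have hcomp := hL.comp z (hφ.differentiableAt z hz).hasFDerivAt
  refine DifferentiableAt.differentiableWithinAt
    (differentiableAt_complex_iff_differentiableAt_real.2 ⟨hcomp.differentiableAt, ?_⟩)
  rw [hcomp.fderiv, ContinuousLinearMap.comp_apply, ContinuousLinearMap.comp_apply]
  -- The Cauchy-Riemann equation is needed only on `1`. For the unit `J = Im q / |Im q|`, `Re (J v)
  -- = -⟨J, v⟩` and `⟨J, J v⟩ = Re v`, that is, `L (J v) = i L v`.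
  have hJ := hφ.fderiv_I_mul z hz 1
  rw [mul_one] at hJ
  rw [hJ, hLv, hLv, complexStructJ]
  have hsq := norm_im_sq_eq (φ z)
  set n := ‖(φ z).im‖
  set v := fderiv ℝ φ z 1
  apply Complex.ext
  · simp
    field_simp
    ring
  · simp
    field_simp
    linear_combination (-v.re) * hsq

/-! ### The spread and the quaternionic Green function -/

theorem ereal_abs_sub_le {x : EReal} {l a b : ℝ} (h1 : ((l + a : ℝ) : EReal) ≤ x)
    (h2 : x ≤ ((l + b : ℝ) : EReal)) :
    (x - (l : EReal)).abs ≤ ENNReal.ofReal (max |a| |b|) := by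
  induction x with
  | bot => simp at h1
  | top => exact absurd (top_le_iff.1 h2) (EReal.coe_ne_top _)
  | coe x =>
    have h1' : l + a ≤ x := by exact_mod_cast h1
    have h2' : x ≤ l + b := by exact_mod_cast h2
    rw [← EReal.coe_sub, EReal.abs_def]
    exact ENNReal.ofReal_le_ofReal (abs_le_max_abs_abs (by linarith) (by linarith))

theorem ereal_le_of_abs_le {x : EReal} {b : ℝ} (hb : 0 ≤ b) (h : x.abs ≤ ENNReal.ofReal b) :
    x ≤ (b : EReal) := by
  induction x with
  | bot => exact bot_le
  | top => simp at h
  | coe x =>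
    rw [EReal.abs_def, ENNReal.ofReal_le_ofReal_iff hb] at h
    exact_mod_cast (le_abs_self x).trans h

section SymmetricSliceDomain

variable {Ω : Set ℍ[ℝ]}

/-- The restriction to a slice of a competitor for the quaternionic Green function is a competitor
for the complex Green function. -/
theorem comp_toSlice_mem {x₀ : ℝ} {v : ℍ[ℝ] → EReal} (hv : v ∈ wshPole Ω (x₀ : ℍ[ℝ]))
    {I : ℍ[ℝ]} (hI : I ∈ imUnits) :
    v ∘ toSlice I ∈ negSubharmonicWithPole (slice Ω I) (x₀ : ℂ) := by
  obtain ⟨⟨-, hsub⟩, hneg, hlim⟩ := hv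
  refine ⟨hsub I hI, fun z hz => hneg _ hz, ?_⟩
  obtain ⟨b, hb, hbt⟩ := exists_between hlim
  have h1 := eventually_lt_of_limsup_lt hb
  have h2 : Tendsto (toSlice I) (𝓝[slice Ω I \ {(x₀ : ℂ)}] x₀)
      (𝓝[Ω \ {(x₀ : ℍ[ℝ])}] (x₀ : ℍ[ℝ])) := by
    refine tendsto_nhdsWithin_iff.2 ⟨?_, ?_⟩
    · have := (continuous_toSlice I).tendsto (x₀ : ℂ)
      rw [toSlice_ofReal] at this
      exact this.mono_left nhdsWithin_le_nhds
    · filter_upwards [self_mem_nhdsWithin] with z hz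
      refine ⟨hz.1, fun h => hz.2 ?_⟩
      have h' : toSlice I z = (x₀ : ℍ[ℝ]) := h
      rw [Set.mem_singleton_iff, ← sub_eq_zero, ← norm_eq_zero, ← norm_toSlice hI,
        ← toSlice_sub_ofReal, h', sub_self, norm_zero]
  -- The finite bound `b` on the absolute value yields the one-sided bound required of planar
  -- competitors.
  refine lt_of_le_of_lt (limsup_le_of_le (by isBoundedDefault) (a := (b.toReal : EReal)) ?_)
    (EReal.coe_lt_top _)
  filter_upwards [h2.eventually h1] with z hz
  refine ereal_le_of_abs_le ENNReal.toReal_nonneg ?_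
  rw [ENNReal.ofReal_toReal hbt.ne, ← norm_toSlice hI, ← toSlice_sub_ofReal]
  exact hz.le

/-- The spread of the complex Green function is a competitor for the quaternionic Green function. -/
theorem IsSpread.mem_wshPole (hΩ : IsOpen Ω) (hsymm : IsAxiallySymmetric Ω)
    (hconn : IsPreconnected (slice Ω unitI)) (hbdd : Bornology.IsBounded Ω) {x₀ : ℝ}
    (hx₀ : (x₀ : ℍ[ℝ]) ∈ Ω) {u : ℍ[ℝ] → EReal}
    (hu : IsSpread Ω (complexGreen (slice Ω unitI) (x₀ : ℂ)) u) :
    u ∈ wshPole Ω (x₀ : ℍ[ℝ]) := by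
  have hD : IsOpen (slice Ω unitI) := isOpen_slice hΩ _
  have hDb : Bornology.IsBounded (slice Ω unitI) := isBounded_slice hbdd unitI_mem
  have hxD : (x₀ : ℂ) ∈ slice Ω unitI := by rwa [slice, Set.mem_preimage, toSlice_ofReal]
  obtain ⟨hγsub, hγneg, -⟩ := complexGreen_mem hD hconn hDb hxD
  have hmaps : Set.MapsTo toHalf Ω (slice Ω unitI) := fun q hq => toHalf_mem_slice hsymm hq
  have heq : Set.EqOn (complexGreen (slice Ω unitI) (x₀ : ℂ) ∘ toHalf) u Ω :=
    fun q hq => (hu.apply_eq hq).symm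
  refine ⟨⟨⟨?_, fun q hq => ?_, ?_⟩, fun I hI => ?_⟩, fun q hq => ?_, ?_⟩
  · exact (upperSemicontinuousOn_comp hγsub.upperSemicontinuousOn
      continuous_toHalf.continuousOn hmaps).congr_eqOn heq
  · rw [hu.apply_eq hq]
    exact hγsub.ne_top _ (hmaps hq)
  · obtain ⟨w, hw, hwb⟩ := hγsub.exists_ne_bot _ hxD
    have hwD := connectedComponentIn_subset _ _ hw
    exact ⟨toSlice unitI w, hwD, by rwa [hu.apply_toSlice unitI_mem hwD]⟩
  · have h1 := slice_eq hsymm hI unitI_mem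
    rw [h1]
    exact hγsub.congr fun z hz => (hu.apply_toSlice hI (h1 ▸ hz)).symm
  · rw [hu.apply_eq hq]
    exact hγneg _ (hmaps hq)
  -- An enclosing disc of radius `R` and an inscribed one of radius `r` pin `u - log |q - x₀|`
  -- between `-log R` and `-log r`.
  · obtain ⟨R, -, hUR⟩ := hDb.subset_ball_lt 0 (x₀ : ℂ)
    obtain ⟨r, hr, hrU⟩ := Metric.nhds_basis_closedBall.mem_iff.1 (hD.mem_nhds hxD)
    refine lt_of_le_of_lt (limsup_le_of_le (by isBoundedDefault)
      (a := ENNReal.ofReal (max |-Real.log R| |-Real.log r|)) ?_) ENNReal.ofReal_lt_top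
    filter_upwards [self_mem_nhdsWithin, mem_nhdsWithin_of_mem_nhds (ball_mem_nhds _ hr)]
      with q hq hqr
    have hne : toHalf q ≠ (x₀ : ℂ) := fun h => hq.2 (by
      rw [Set.mem_singleton_iff, ← sub_eq_zero, ← norm_eq_zero, ← norm_toHalf_sub, h, sub_self,
        norm_zero])
    rw [hu.apply_eq hq.1, ← norm_toHalf_sub]
    refine ereal_abs_sub_le ?_ ?_
    · exact log_le_complexGreen hD hUR hne
    · refine complexGreen_le_log hrU ?_ hne
      rw [mem_ball_iff_norm, norm_toHalf_sub]
      exact mem_ball_iff_norm.1 hqr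

/-- The spread of the complex Green function is plurisubharmonic with respect to `𝕁`. -/
theorem IsSpread.isJPlurisubharmonicOn (hΩ : IsOpen Ω) (hsymm : IsAxiallySymmetric Ω)
    (hconn : IsPreconnected (slice Ω unitI)) (hbdd : Bornology.IsBounded Ω) {x₀ : ℝ}
    (hx₀ : (x₀ : ℍ[ℝ]) ∈ Ω) {u : ℍ[ℝ] → EReal}
    (hu : IsSpread Ω (complexGreen (slice Ω unitI) (x₀ : ℂ)) u) :
    IsJPlurisubharmonicOn u (Ω \ realAxis) := by
  have hD : IsOpen (slice Ω unitI) := isOpen_slice hΩ _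
  have hDb : Bornology.IsBounded (slice Ω unitI) := isBounded_slice hbdd unitI_mem
  have hxD : (x₀ : ℂ) ∈ slice Ω unitI := by rwa [slice, Set.mem_preimage, toSlice_ofReal]
  have hγ := (complexGreen_mem hD hconn hDb hxD).1
  obtain ⟨⟨⟨husc, htop, -⟩, -⟩, -⟩ := hu.mem_wshPole hΩ hsymm hconn hbdd hx₀
  refine ⟨husc.mono Set.sdiff_subset, fun q hq => htop q hq.1, fun q hq =>
    ⟨q, mem_connectedComponentIn hq, ?_⟩, fun V φ hV hVc hφ => ?_⟩
  -- The lower logarithmic bound makes `u` finite at every nonreal point, so `q` itself is the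
  -- witness in its component.
  · obtain ⟨R, -, hUR⟩ := hDb.subset_ball_lt 0 (x₀ : ℂ)
    have hne : toHalf q ≠ (x₀ : ℂ) := fun h => hq.2 ⟨x₀, by
      rw [eq_comm, ← sub_eq_zero, ← norm_eq_zero, ← norm_toHalf_sub, h, sub_self, norm_zero]⟩
    rw [hu.apply_eq hq.1]
    exact ne_bot_of_le_ne_bot (EReal.coe_ne_bot _) (log_le_complexGreen hD hUR hne)
  · have heq : ∀ z ∈ V, u (φ z) = complexGreen (slice Ω unitI) (x₀ : ℂ) (toHalf (φ z)) :=
      fun z hz => hu.apply_eq (hφ.mapsTo hz).1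
    rcases hγ.comp_holomorphic hD hV hVc.isPreconnected
      (hφ.differentiableOn_toHalf disjoint_sdiff_self_left)
      (fun z hz => toHalf_mem_slice hsymm (hφ.mapsTo hz).1) with h | h
    · exact Or.inl fun z hz => (heq z hz).trans (h z hz)
    · exact Or.inr (h.congr fun z hz => (heq z hz).symm)

/-- The spread of the complex Green function dominates all competitors for the quaternionic Green
function. -/
theorem IsSpread.supWshPole_le (hsymm : IsAxiallySymmetric Ω) {x₀ : ℝ} {u : ℍ[ℝ] → EReal}
    (hu : IsSpread Ω (complexGreen (slice Ω unitI) (x₀ : ℂ)) u) {q : ℍ[ℝ]} (hq : q ∈ Ω) :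
    supWshPole Ω (x₀ : ℍ[ℝ]) q ≤ u q := by
  refine iSup₂_le fun v hv => ?_
  -- The comparison takes place on a slice through `q`.
  obtain ⟨I, hI, hqI⟩ := exists_toSlice_toHalf q
  have h1 := le_complexGreen (comp_toSlice_mem hv hI) (toHalf q)
  rwa [Function.comp_apply, hqI, slice_eq hsymm hI unitI_mem, ← hu.apply_eq hq] at h1

/-- The spread of the complex Green function is the quaternionic Green function. -/
theorem IsSpread.eqOn_quatGreen (hΩ : IsOpen Ω) (hsymm : IsAxiallySymmetric Ω)
    (hconn : IsPreconnected (slice Ω unitI)) (hbdd : Bornology.IsBounded Ω) {x₀ : ℝ}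
    (hx₀ : (x₀ : ℍ[ℝ]) ∈ Ω) {u : ℍ[ℝ] → EReal}
    (hu : IsSpread Ω (complexGreen (slice Ω unitI) (x₀ : ℂ)) u) :
    Set.EqOn u (quatGreen Ω (x₀ : ℍ[ℝ])) Ω := by
  intro q hq
  have hmem := hu.mem_wshPole hΩ hsymm hconn hbdd hx₀
  apply le_antisymm
  · have h1 : u q ≤ supWshPole Ω (x₀ : ℍ[ℝ]) q :=
      le_iSup₂ (f := fun (v : ℍ[ℝ] → EReal) (_ : v ∈ wshPole Ω (x₀ : ℍ[ℝ])) => v q) u hmem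
    exact h1.trans (le_limsup_of_frequently_le
      (Frequently.filter_mono (f := pure q) (by simp) (pure_le_nhdsWithin hq)))
  · refine le_trans (limsup_le_limsup ?_) (upperSemicontinuousOn_iff_limsup_le.1 hmem.1.1.1 q hq)
    filter_upwards [self_mem_nhdsWithin] with p hp
    exact hu.supWshPole_le hsymm hp

end SymmetricSliceDomain

end SliceGreen

end

/-- Well-definedness is expressed as existence of a spread together with uniqueness on `Ω`; values
off `Ω` are unconstrained. -/
theorem mainTheorem5 (Ω : Set ℍ[ℝ]) (hΩ : SliceGreen.IsSliceDomain Ω)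
    (hsymm : SliceGreen.IsAxiallySymmetric Ω) (hbdd : Bornology.IsBounded Ω)
    (x₀ : ℝ) (hx₀ : (x₀ : ℍ[ℝ]) ∈ Ω) :
    (∃ u : ℍ[ℝ] → EReal,
      SliceGreen.IsSpread Ω
        (SliceGreen.complexGreen (SliceGreen.slice Ω SliceGreen.unitI) (x₀ : ℂ)) u) ∧
    ∀ u : ℍ[ℝ] → EReal,
      SliceGreen.IsSpread Ω
        (SliceGreen.complexGreen (SliceGreen.slice Ω SliceGreen.unitI) (x₀ : ℂ)) u →
      (∀ v : ℍ[ℝ] → EReal,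
        SliceGreen.IsSpread Ω
          (SliceGreen.complexGreen (SliceGreen.slice Ω SliceGreen.unitI) (x₀ : ℂ)) v →
        Set.EqOn v u Ω) ∧
      SliceGreen.IsJPlurisubharmonicOn u (Ω \ SliceGreen.realAxis) ∧
      u ∈ SliceGreen.wshPole Ω (x₀ : ℍ[ℝ]) ∧
      Set.EqOn u (SliceGreen.quatGreen Ω (x₀ : ℍ[ℝ])) Ω := by
  have hopen : IsOpen Ω := hΩ.isDomainSet.1
  have hconn := SliceGreen.isPreconnected_slice_unitI hΩ
  refine ⟨⟨_, SliceGreen.isSpread_comp_toHalf (SliceGreen.complexGreen_conj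
    (fun z hz => SliceGreen.conj_mem_slice hsymm SliceGreen.unitI_mem hz) hconn x₀)⟩,
    fun u hu => ⟨fun v hv q hq => ?_, hu.isJPlurisubharmonicOn hopen hsymm hconn hbdd hx₀,
      hu.mem_wshPole hopen hsymm hconn hbdd hx₀, hu.eqOn_quatGreen hopen hsymm hconn hbdd hx₀⟩⟩
  rw [hv.apply_eq hq, hu.apply_eq hq]
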